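/- Theorem 1.2. Let $\triangle_H=\{(z,w)\in\mathbb C^2: |z|<|w|<1\}$ be the Hartogs triangle and let $H^2(\triangle_H)$ be the Hilbert space of all holomorphic functions $f$ on $\triangle_H$ with $$\|f\|^2=\sup_{0<s,t<1}\frac1{4\pi^2}\int_0^{2\pi}\!\!\int_0^{2\pi}\bigl|f(st\,e^{i\theta},t\,e^{i\gamma})\bigr|^2\,st^2\,d\theta\,d\gamma<\infty .$$ Let $M_z,M_w$ be multiplication by the coordinate functions on $H^2(\triangle_H)$. A quotient module is a closed subspace $\mathcal Q\subseteq H^2(\triangle_H)$ with $M_z^*\mathcal Q\subseteq\mathcal Q$ and $M_w^*\mathcal Q\subseteq\mathcal Q$; with $Q_z=P_{\mathcal Q}M_z|_{\mathcal Q}$ and $Q_w=P_{\mathcal Q}M_w|_{\mathcal Q}$, it is called doubly commuting if $Q_z^*Q_w=Q_wQ_z^*$. Let $\theta_1,\theta_2$ be inner functions on the open unit disc $\mathbb D$, i.e. holomorphic functions with $|\theta_k|\le 1$ on $\mathbb D$ whose radial limits have modulus one almost everywhere on the unit circle $\mathbb T$. Then the quotient module $$H^2(\triangle_H)\ominus \theta_1(z/w)\,\theta_2(w)\,H^2(\triangle_H)$$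 is doubly commuting if and only if one of the following holds: (i) $\theta_1$ and $\theta_2$ are constant; (ii) $\theta_1$ is constant and $\theta_2(w)=c\,\dfrac{w-b}{1-\bar b w}$ for some $b\in\mathbb D$ and $c\in\mathbb T$; (iii) $\theta_2$ is constant and $\theta_1(z)=c_1z$ for some $c_1\in\mathbb T$; (iv) $\theta_1(z)=c_1z$ and $\theta_2(w)=c_2w$ for some $c_1,c_2\in\mathbb T$. -/

import Mathlib

noncomputable section

namespace Hartogs

open Complex MeasureTheory Set Filter Topology

/-- The Hartogs triangle `{(z, w) : |z| < |w| < 1}`. -/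
def hartogsTriangle : Set (ℂ × ℂ) := {p | ‖p.1‖ < ‖p.2‖ ∧ ‖p.2‖ < 1}

/-- The weighted mean `(4π²)⁻¹ ∫∫ |f(s t e^{iθ}, t e^{iγ})|² s t² dθ dγ`. -/
def hardyMean (f : ℂ × ℂ → ℂ) (s t : ℝ) : ℝ :=
  1 / (4 * Real.pi ^ 2) * ∫ θ in (0 : ℝ)..(2 * Real.pi), ∫ γ in (0 : ℝ)..(2 * Real.pi),
    ‖f (s * t * exp (θ * I), t * exp (γ * I))‖ ^ 2 * (s * t ^ 2)

theorem isOpen_hartogsTriangle : IsOpen hartogsTriangle :=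
  (isOpen_lt continuous_fst.norm continuous_snd.norm).inter
    (isOpen_lt continuous_snd.norm continuous_const)

theorem mem_hartogsTriangle_polar {r t : ℝ} (hr : 0 ≤ r) (hrt : r < t) (ht : t < 1) (a b : ℝ) :
    ((r : ℂ) * exp (a * I), (t : ℂ) * exp (b * I)) ∈ hartogsTriangle := by
  have ht0 : 0 < t := hr.trans_lt hrt
  simp [hartogsTriangle, norm_exp_ofReal_mul_I, abs_of_nonneg hr, abs_of_pos ht0, hrt, ht]

theorem continuous_polar {f : ℂ × ℂ → ℂ} (hf : ContinuousOn f hartogsTriangle) {r t : ℝ}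
    (hr : 0 ≤ r) (hrt : r < t) (ht : t < 1) :
    Continuous fun x : ℝ × ℝ => f ((r : ℂ) * exp (x.1 * I), (t : ℂ) * exp (x.2 * I)) :=
  hf.comp_continuous (by fun_prop) fun x => mem_hartogsTriangle_polar hr hrt ht x.1 x.2

theorem continuous_polar_torus {f : ℂ × ℂ → ℂ} (hf : ContinuousOn f hartogsTriangle) {r t : ℝ}
    (hr : 0 ≤ r) (hrt : r < t) (ht : t < 1) :
    Continuous fun x : UnitAddTorus (Fin 2) =>
      f ((r : ℂ) * fourier 1 (x 0), (t : ℂ) * fourier 1 (x 1)) := by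
  refine hf.comp_continuous (by fun_prop) fun x => ?_
  have ht0 : 0 < t := hr.trans_lt hrt
  have h1 : ∀ y : UnitAddCircle, ‖fourier 1 y‖ = 1 := fun y => by
    rw [fourier_apply]; exact Circle.norm_coe _
  simp only [hartogsTriangle, mem_ofPred_eq, norm_mul, h1, norm_real, Real.norm_eq_abs,
    abs_of_nonneg hr, abs_of_pos ht0, mul_one]
  exact ⟨hrt, ht⟩

theorem cube_integral {E : Type*} [NormedAddCommGroup E] [NormedSpace ℝ E] 
    (H : ℝ → ℝ → E) (hH : Continuous (Function.uncurry H)) :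
    ∫ x in {x : Fin 2 → ℝ | ∀ i, x i ∈ Ioc ((0 : Fin 2 → ℝ) i) ((0 : Fin 2 → ℝ) i + 1)},
      H (2 * Real.pi * x 0) (2 * Real.pi * x 1) =
    (1 / (4 * Real.pi ^ 2)) • ∫ a in (0 : ℝ)..(2 * Real.pi), ∫ b in (0 : ℝ)..(2 * Real.pi), H a b := by
  have e := (volume_preserving_finTwoArrow ℝ).setIntegral_preimage_emb
    (MeasurableEquiv.finTwoArrow (α := ℝ)).measurableEmbedding
    (fun p : ℝ × ℝ => H (2 * Real.pi * p.1) (2 * Real.pi * p.2)) (Ioc 0 1 ×ˢ Ioc 0 1)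
  have hset : (MeasurableEquiv.finTwoArrow (α := ℝ)) ⁻¹' (Ioc 0 1 ×ˢ Ioc 0 1) =
      {x : Fin 2 → ℝ | ∀ i, x i ∈ Ioc ((0 : Fin 2 → ℝ) i) ((0 : Fin 2 → ℝ) i + 1)} := by
    ext x
    simp [MeasurableEquiv.finTwoArrow, Fin.forall_fin_two]
  rw [hset] at e
  have hpi : (2 * Real.pi) ≠ 0 := by positivity
  refine e.trans ?_
  have hc : Continuous fun p : ℝ × ℝ => H (2 * Real.pi * p.1) (2 * Real.pi * p.2) :=
    hH.comp (by fun_prop : Continuous fun p : ℝ × ℝ => (2 * Real.pi * p.1, 2 * Real.pi * p.2))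
  rw [Measure.volume_eq_prod, setIntegral_prod _ ((hc.continuousOn.integrableOn_compact
    (isCompact_Icc.prod isCompact_Icc)).mono_set
      (prod_mono Ioc_subset_Icc_self Ioc_subset_Icc_self))]
  simp only [← intervalIntegral.integral_of_le zero_le_one]
  have h1 : ∀ x : ℝ, ∫ y in (0 : ℝ)..1, H (2 * Real.pi * x) (2 * Real.pi * y) =
      (2 * Real.pi)⁻¹ • ∫ b in (0 : ℝ)..(2 * Real.pi), H (2 * Real.pi * x) b := fun x => by
    rw [intervalIntegral.integral_comp_mul_left (fun b => H (2 * Real.pi * x) b) hpi]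
    simp
  simp only [h1]
  rw [intervalIntegral.integral_comp_mul_left
    (fun a => (2 * Real.pi)⁻¹ • ∫ b in (0 : ℝ)..(2 * Real.pi), H a b) hpi,
    intervalIntegral.integral_smul, smul_smul]
  simp only [mul_zero, mul_one]
  congr 1
  field_simp
  ring

/-- The function `(x₀, x₁) ↦ f (r e(x₀), t e(x₁))` on the torus. -/
def polarMap (f : ℂ × ℂ → ℂ) (hf : ContinuousOn f hartogsTriangle) (r t : ℝ)
    (hr : 0 ≤ r) (hrt : r < t) (ht : t < 1) : C(UnitAddTorus (Fin 2), ℂ) :=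
  ⟨_, continuous_polar_torus hf hr hrt ht⟩

/-- The Laurent coefficient of `z ^ m * w ^ n`, computed on the torus of radii `r`, `t`. -/
def laurentCoeff (f : ℂ × ℂ → ℂ) (r t : ℝ) (m n : ℤ) : ℂ :=
  (1 / (4 * Real.pi ^ 2) : ℝ) • ∫ a in (0 : ℝ)..(2 * Real.pi), ∫ b in (0 : ℝ)..(2 * Real.pi),
    ((r : ℂ) * exp (a * I)) ^ (-m) * ((t : ℂ) * exp (b * I)) ^ (-n) *
      f ((r : ℂ) * exp (a * I), (t : ℂ) * exp (b * I))

theorem fourier_two_pi (x : ℝ) (n : ℤ) :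
    fourier n (x : UnitAddCircle) = exp ((2 * Real.pi * x : ℝ) * I) ^ n := by
  rw [fourier_coe_apply, ← Complex.exp_int_mul]
  congr 1
  push_cast
  ring

theorem mFourierCoeff_polarMap {f : ℂ × ℂ → ℂ} (hf : ContinuousOn f hartogsTriangle) {r t : ℝ}
    (hr : 0 < r) (hrt : r < t) (ht : t < 1) (n : Fin 2 → ℤ) :
    UnitAddTorus.mFourierCoeff (polarMap f hf r t hr.le hrt ht) n =
      (r : ℂ) ^ n 0 * (t : ℂ) ^ n 1 * laurentCoeff f r t (n 0) (n 1) := by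
  have ht0 : 0 < t := hr.trans hrt
  have hrc : (r : ℂ) ≠ 0 := by exact_mod_cast hr.ne'
  have htc : (t : ℂ) ≠ 0 := by exact_mod_cast ht0.ne'
  rw [UnitAddTorus.mFourierCoeff_eq_integral _ _ 0]
  have hc := continuous_polar hf hr.le hrt ht
  have := cube_integral (fun a b : ℝ => (r : ℂ) ^ n 0 * (t : ℂ) ^ n 1 * (((r : ℂ) * exp (a * I)) ^ (-n 0) *
    ((t : ℂ) * exp (b * I)) ^ (-n 1) * f ((r : ℂ) * exp (a * I), (t : ℂ) * exp (b * I)))) (by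
      refine Continuous.mul (by fun_prop) (Continuous.mul (Continuous.mul ?_ ?_) hc)
      · exact Continuous.zpow₀ (by fun_prop) _ (fun x => Or.inl (by simp [hrc]))
      · exact Continuous.zpow₀ (by fun_prop) _ (fun x => Or.inl (by simp [htc])))
  simp only [intervalIntegral.integral_const_mul] at this
  rw [laurentCoeff, mul_smul_comm, ← this]
  congr 1
  ext x
  have e1 := fourier_two_pi (x 0)
  have e2 := fourier_two_pi (x 1)
  simp only [UnitAddTorus.mFourier, polarMap, ContinuousMap.coe_mk, Fin.prod_univ_two, e1, e2, Pi.neg_apply, smul_eq_mul, mul_zpow, zpow_one, zpow_neg]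
  field_simp

theorem hasSum_hardyMean {f : ℂ × ℂ → ℂ} (hf : ContinuousOn f hartogsTriangle) {s t : ℝ}
    (hs : s ∈ Ioo (0 : ℝ) 1) (ht : t ∈ Ioo (0 : ℝ) 1) :
    HasSum (fun n : Fin 2 → ℤ => ‖laurentCoeff f (s * t) t (n 0) (n 1)‖ ^ 2 *
      (s ^ (2 * n 0 + 1) * t ^ (2 * (n 0 + n 1 + 1)))) (hardyMean f s t) := by
  have hr : 0 < s * t := mul_pos hs.1 ht.1
  have hrt : s * t < t := by nlinarith [hs.1, hs.2, ht.1]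
  have h := UnitAddTorus.hasSum_sq_mFourierCoeff
    (ContinuousMap.toLp (E := ℂ) 2 (Measure.pi fun _ : Fin 2 => AddCircle.haarAddCircle (T := 1)) ℂ
      (polarMap f hf (s * t) t hr.le hrt ht.2))
  replace h := h.congr_fun (fun n => (congrArg (fun c => ‖c‖ ^ 2) ((UnitAddTorus.mFourierCoeff_toLp _ n).trans
    (mFourierCoeff_polarMap hf hr hrt ht.2 n))).symm)
  have e : hardyMean f s t = s * t ^ 2 * ∫ x, ‖(polarMap f hf (s * t) t hr.le hrt ht.2) x‖ ^ 2
      ∂(Measure.pi fun _ : Fin 2 => AddCircle.haarAddCircle (T := 1)) := by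
    have hc := continuous_polar hf hr.le hrt ht.2
    have := cube_integral (fun a b : ℝ =>
      ‖f (((s * t : ℝ) : ℂ) * exp (a * I), (t : ℂ) * exp (b * I))‖ ^ 2) ((continuous_pow 2).comp hc.norm)
    have h2 := UnitAddTorus.integral_preimage
      (fun x => ‖(polarMap f hf (s * t) t hr.le hrt ht.2) x‖ ^ 2) 0
    have h3 : ∀ x : Fin 2 → ℝ, ‖(polarMap f hf (s * t) t hr.le hrt ht.2) (fun i => (x i : UnitAddCircle))‖ ^ 2 =
       ‖f (((s * t : ℝ) : ℂ) * exp ((2 * Real.pi * x 0 : ℝ) * I), (t : ℂ) * exp ((2 * Real.pi * x 1 : ℝ) * I))‖ ^ 2 := fun x => by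
      simp only [polarMap, ContinuousMap.coe_mk, fourier_two_pi, zpow_one]
    simp only [h3] at h2
    refine Eq.trans ?_ (congrArg _ (h2.trans this).symm)
    simp only [hardyMean, intervalIntegral.integral_mul_const, smul_eq_mul]
    push_cast
    ring
  have h4 : ∫ x, ‖(polarMap f hf (s * t) t hr.le hrt ht.2) x‖ ^ 2
      ∂(Measure.pi fun _ : Fin 2 => AddCircle.haarAddCircle (T := 1)) = ∫ x, ‖(ContinuousMap.toLp (E := ℂ) 2 (Measure.pi fun _ : Fin 2 => AddCircle.haarAddCircle (T := 1)) ℂ (polarMap f hf (s * t) t hr.le hrt ht.2)) x‖ ^ 2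
      ∂(Measure.pi fun _ : Fin 2 => AddCircle.haarAddCircle (T := 1)) := by
    refine integral_congr_ae ?_
    filter_upwards [ContinuousMap.coeFn_toLp (p := 2) (𝕜 := ℂ) (Measure.pi fun _ : Fin 2 => AddCircle.haarAddCircle (T := 1)) (polarMap f hf (s * t) t hr.le hrt ht.2)] with x hx
    rw [hx]
  rw [e, h4]
  refine (h.mul_left (s * t ^ 2)).congr_fun fun n => ?_
  have hs0 := hs.1.ne'
  have ht0 := ht.1.ne'
  rw [norm_mul, norm_mul, norm_zpow, norm_zpow, norm_real, norm_real, Real.norm_of_nonneg hr.le,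
    Real.norm_of_nonneg ht.1.le, zpow_add₀ hs0, zpow_mul, zpow_mul, zpow_add₀ (by positivity), zpow_add₀ (by positivity)]
  simp only [mul_zpow, zpow_one, ← zpow_natCast, ← zpow_mul, mul_comm (2 : ℤ)]
  push_cast
  ring

theorem circle_integral_eq_of_annulus {g : ℂ → ℂ} {U : Set ℂ} (hU : IsOpen U)
    (hg : DifferentiableOn ℂ g U) {r R : ℝ} (hr : 0 < r) (hrR : r ≤ R)
    (hsub : ∀ z : ℂ, r ≤ ‖z‖ → ‖z‖ ≤ R → z ∈ U) :
    ∫ a in (0 : ℝ)..(2 * Real.pi), g ((R : ℂ) * exp (a * I)) =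
      ∫ a in (0 : ℝ)..(2 * Real.pi), g ((r : ℂ) * exp (a * I)) := by
  have h := circleIntegral_sub_center_inv_smul_eq_of_differentiable_on_annulus_off_countable
    (c := 0) (f := g) hr hrR countable_empty
    (hg.continuousOn.mono fun z hz => hsub z (by simpa using hz.2) (by simpa using hz.1))
    (fun z hz => hg.differentiableAt (hU.mem_nhds (hsub z
      (by have := hz.1.2; simp at this; exact this.le) (by have := hz.1.1; simp at this; exact this.le))))
  have h1 := Real.circleAverage_eq_circleIntegral (f := g) (c := 0) (R := R) (hr.trans_le hrR).ne'
  have h2 := Real.circleAverage_eq_circleIntegral (f := g) (c := 0) (R := r) hr.ne'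
  rw [h, ← h2, Real.circleAverage_def, Real.circleAverage_def] at h1
  have h3 : (2 * Real.pi)⁻¹ ≠ 0 := by positivity
  simpa [circleMap] using (smul_right_injective ℂ h3 h1)

theorem laurentCoeff_eq_of_radius {f : ℂ × ℂ → ℂ} (hf : DifferentiableOn ℂ f hartogsTriangle)
    {r t r' t' : ℝ} (hr : 0 < r) (hrt : r < t) (ht : t < 1) (hr' : 0 < r') (hrt' : r' < t')
    (ht' : t' < 1) (m n : ℤ) : laurentCoeff f r t m n = laurentCoeff f r' t' m n := by
  have A : ∀ {r t t' : ℝ}, 0 < r → r < t → t ≤ t' → t' < 1 →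
      laurentCoeff f r t' m n = laurentCoeff f r t m n := by
    intro r t t' hr hrt htt' ht'
    rw [laurentCoeff, laurentCoeff]
    congr 2
    ext a
    have hz : ‖(r : ℂ) * exp (a * I)‖ = r := by
      rw [norm_mul, norm_exp_ofReal_mul_I, norm_real, Real.norm_of_nonneg hr.le, mul_one]
    refine circle_integral_eq_of_annulus (g := fun w => ((r : ℂ) * exp (a * I)) ^ (-m) * w ^ (-n) *
      f ((r : ℂ) * exp (a * I), w)) (U := {w : ℂ | ((r : ℂ) * exp (a * I), w) ∈ hartogsTriangle})
      (isOpen_hartogsTriangle.preimage (by fun_prop)) ?_ (hr.trans hrt) htt' ?_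
    · intro w hw
      have hw0 : w ≠ 0 := by
        rintro rfl
        have := hw.1
        simp only [hz, norm_zero] at this
        linarith
      refine DifferentiableAt.differentiableWithinAt ?_
      refine (((differentiableAt_zpow.2 (Or.inl hw0)).const_mul _)).mul ?_
      exact (hf.differentiableAt (isOpen_hartogsTriangle.mem_nhds hw)).comp w (by fun_prop)
    · intro w h1 h2
      exact ⟨by rw [hz]; linarith, by simpa using h2.trans_lt ht'⟩
  have hcont : ∀ {r t : ℝ}, 0 < r → r < t → t < 1 → Continuous fun x : ℝ × ℝ =>
      ((r : ℂ) * exp (x.1 * I)) ^ (-m) * ((t : ℂ) * exp (x.2 * I)) ^ (-n) *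
      f ((r : ℂ) * exp (x.1 * I), (t : ℂ) * exp (x.2 * I)) := by
    intro r t hr hrt ht
    have hrc : (r : ℂ) ≠ 0 := by exact_mod_cast hr.ne'
    have htc : (t : ℂ) ≠ 0 := by exact_mod_cast (hr.trans hrt).ne'
    refine Continuous.mul (Continuous.mul ?_ ?_) (continuous_polar hf.continuousOn hr.le hrt ht)
    · exact Continuous.zpow₀ (by fun_prop) _ (fun x => Or.inl (by simp [hrc]))
    · exact Continuous.zpow₀ (by fun_prop) _ (fun x => Or.inl (by simp [htc]))
  have swap : ∀ {r t : ℝ}, 0 < r → r < t → t < 1 → laurentCoeff f r t m n =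
      (1 / (4 * Real.pi ^ 2) : ℝ) • ∫ b in (0 : ℝ)..(2 * Real.pi), ∫ a in (0 : ℝ)..(2 * Real.pi),
      ((r : ℂ) * exp (a * I)) ^ (-m) * ((t : ℂ) * exp (b * I)) ^ (-n) *
      f ((r : ℂ) * exp (a * I), (t : ℂ) * exp (b * I)) := by
    intro r t hr hrt ht
    rw [laurentCoeff]
    simp only [intervalIntegral.integral_of_le Real.two_pi_pos.le]
    rw [integral_integral_swap]
    rw [Measure.prod_restrict, ← Measure.volume_eq_prod]
    exact ((hcont hr hrt ht).continuousOn.integrableOn_compact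
      (isCompact_Icc.prod isCompact_Icc)).mono_set
      (prod_mono Ioc_subset_Icc_self Ioc_subset_Icc_self)
  have B : ∀ {r r' t : ℝ}, 0 < r → r ≤ r' → r' < t → t < 1 →
      laurentCoeff f r' t m n = laurentCoeff f r t m n := by
    intro r r' t hr hrr' hrt ht
    rw [swap hr (hrr'.trans_lt hrt) ht, swap (hr.trans_le hrr') hrt ht]
    congr 2
    ext b
    have hz : ‖(t : ℂ) * exp (b * I)‖ = t := by
      rw [norm_mul, norm_exp_ofReal_mul_I, norm_real, Real.norm_of_nonneg (by linarith), mul_one]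
    refine circle_integral_eq_of_annulus (g := fun z => z ^ (-m) * ((t : ℂ) * exp (b * I)) ^ (-n) *
      f (z, (t : ℂ) * exp (b * I)))
      (U := {z : ℂ | z ≠ 0 ∧ (z, (t : ℂ) * exp (b * I)) ∈ hartogsTriangle})
      (isOpen_ne.inter (isOpen_hartogsTriangle.preimage (by fun_prop))) ?_ hr hrr' ?_
    · intro z hw
      refine DifferentiableAt.differentiableWithinAt ?_
      refine (((differentiableAt_zpow.2 (Or.inl hw.1)).mul_const _)).mul ?_
      exact (hf.differentiableAt (isOpen_hartogsTriangle.mem_nhds hw.2)).comp z (by fun_prop)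
    · intro z h1 h2
      refine ⟨?_, ?_, ?_⟩
      · rintro rfl
        simp at h1
        linarith
      · simp only [hz]; linarith
      · simpa only [hz] using ht
  have h0 : 0 < min r r' := lt_min hr hr'
  have h1 := B h0 (min_le_left r r') hrt ht
  have h2 := B h0 (min_le_right r r') hrt' ht'
  rw [h1, h2]
  rcases le_total t t' with h | h
  · exact (A h0 ((min_le_left _ _).trans_lt hrt) h ht').symm
  · exact A h0 ((min_le_right _ _).trans_lt hrt') h ht

theorem continuous_laurent_integrand {f : ℂ × ℂ → ℂ} (hf : ContinuousOn f hartogsTriangle)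
    {r t : ℝ} (hr : 0 < r) (hrt : r < t) (ht : t < 1) (m n : ℤ) : Continuous fun x : ℝ × ℝ =>
      ((r : ℂ) * exp (x.1 * I)) ^ (-m) * ((t : ℂ) * exp (x.2 * I)) ^ (-n) *
      f ((r : ℂ) * exp (x.1 * I), (t : ℂ) * exp (x.2 * I)) := by
  have hrc : (r : ℂ) ≠ 0 := by exact_mod_cast hr.ne'
  have htc : (t : ℂ) ≠ 0 := by exact_mod_cast (hr.trans hrt).ne'
  refine Continuous.mul (Continuous.mul ?_ ?_) (continuous_polar hf hr.le hrt ht)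
  · exact Continuous.zpow₀ (by fun_prop) _ (fun x => Or.inl (by simp [hrc]))
  · exact Continuous.zpow₀ (by fun_prop) _ (fun x => Or.inl (by simp [htc]))

theorem laurentCoeff_add {f g : ℂ × ℂ → ℂ} (hf : ContinuousOn f hartogsTriangle)
    (hg : ContinuousOn g hartogsTriangle) {r t : ℝ} (hr : 0 < r) (hrt : r < t) (ht : t < 1)
    (m n : ℤ) : laurentCoeff (f + g) r t m n = laurentCoeff f r t m n + laurentCoeff g r t m n := by
  have cf := continuous_laurent_integrand hf hr hrt ht m n
  have cg := continuous_laurent_integrand hg hr hrt ht m n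
  rw [laurentCoeff, laurentCoeff, laurentCoeff, ← smul_add, ← intervalIntegral.integral_add]
  · congr 2
    ext a
    rw [← intervalIntegral.integral_add]
    · simp only [Pi.add_apply, mul_add]
    · exact (cf.comp (by fun_prop : Continuous fun b : ℝ => (a, b))).intervalIntegrable _ _
    · exact (cg.comp (by fun_prop : Continuous fun b : ℝ => (a, b))).intervalIntegrable _ _
  · exact (intervalIntegral.continuous_parametric_intervalIntegral_of_continuous' cf
      _ _).intervalIntegrable _ _
  · exact (intervalIntegral.continuous_parametric_intervalIntegral_of_continuous' cg
      _ _).intervalIntegrable _ _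

theorem laurentCoeff_smul (c : ℂ) (f : ℂ × ℂ → ℂ) (r t : ℝ) (m n : ℤ) :
    laurentCoeff (c • f) r t m n = c * laurentCoeff f r t m n := by
  simp only [laurentCoeff, Pi.smul_apply, smul_eq_mul, mul_left_comm _ c,
    intervalIntegral.integral_const_mul, mul_smul_comm]

theorem hardyMean_smul (c : ℂ) (f : ℂ × ℂ → ℂ) (s t : ℝ) :
    hardyMean (c • f) s t = ‖c‖ ^ 2 * hardyMean f s t := by
  simp only [hardyMean, Pi.smul_apply, smul_eq_mul, norm_mul, mul_pow, mul_assoc,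
    intervalIntegral.integral_const_mul]
  ring

theorem hardyMean_add_le {f g : ℂ × ℂ → ℂ} (hf : ContinuousOn f hartogsTriangle)
    (hg : ContinuousOn g hartogsTriangle) {s t : ℝ} (hs : s ∈ Ioo (0 : ℝ) 1)
    (ht : t ∈ Ioo (0 : ℝ) 1) :
    hardyMean (f + g) s t ≤ 2 * hardyMean f s t + 2 * hardyMean g s t := by
  refine hasSum_le ?_ (hasSum_hardyMean (hf.add hg) hs ht)
    (((hasSum_hardyMean hf hs ht).mul_left 2).add ((hasSum_hardyMean hg hs ht).mul_left 2))
  intro n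
  rw [laurentCoeff_add hf hg (mul_pos hs.1 ht.1) (by nlinarith [hs.1, hs.2, ht.1]) ht.2,
    ← mul_assoc 2, ← mul_assoc 2, ← add_mul]
  have := hs.1
  have := ht.1
  refine mul_le_mul_of_nonneg_right ?_ (by positivity)
  refine (pow_le_pow_left₀ (norm_nonneg _) (norm_add_le _ _) 2).trans ?_
  nlinarith [sq_nonneg (‖laurentCoeff f (s * t) t (n 0) (n 1)‖ -
    ‖laurentCoeff g (s * t) t (n 0) (n 1)‖)]

/-- The underlying vector space of the Hardy space `H²` of the Hartogs triangle: the holomorphic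
functions on the triangle whose means `hardyMean f s t`, `0 < s, t < 1`, are bounded. Functions on
the triangle are represented by their extension by zero to `ℂ × ℂ`, so that equality is equality on
the triangle. -/
def hardySubmodule : Submodule ℂ (ℂ × ℂ → ℂ) where
  carrier := {f | DifferentiableOn ℂ f hartogsTriangle ∧
    (∃ C : ℝ, ∀ s ∈ Ioo (0 : ℝ) 1, ∀ t ∈ Ioo (0 : ℝ) 1, hardyMean f s t ≤ C) ∧
    ∀ p, p ∉ hartogsTriangle → f p = 0}
  add_mem' := by
    rintro f g ⟨hf, ⟨C, hC⟩, hf0⟩ ⟨hg, ⟨D, hD⟩, hg0⟩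
    refine ⟨hf.add hg, ⟨2 * C + 2 * D, fun s hs t ht => ?_⟩, fun p hp => by
      simp [hf0 p hp, hg0 p hp]⟩
    have := hardyMean_add_le hf.continuousOn hg.continuousOn hs ht
    linarith [hC s hs t ht, hD s hs t ht]
  zero_mem' := ⟨differentiableOn_const 0, ⟨0, fun s _ t _ => by simp [hardyMean]⟩, fun _ _ => rfl⟩
  smul_mem' := by
    rintro c f ⟨hf, ⟨C, hC⟩, hf0⟩
    refine ⟨hf.const_smul c, ⟨‖c‖ ^ 2 * C, fun s hs t ht => ?_⟩, fun p hp => by simp [hf0 p hp]⟩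
    rw [hardyMean_smul]
    exact mul_le_mul_of_nonneg_left (hC s hs t ht) (by positivity)

/-- The exponent `(m, n)` of the monomial `z ^ m w ^ n = w⁻¹ (z / w) ^ i w ^ j`. -/
def hardyExp (p : ℕ × ℕ) : Fin 2 → ℤ := ![(p.1 : ℤ), (p.2 : ℤ) - p.1 - 1]

theorem hardyExp_injective : Function.Injective hardyExp := by
  rintro ⟨a, b⟩ ⟨c, d⟩ h
  have h0 := congrFun h 0
  have h1 := congrFun h 1
  simp [hardyExp] at h0 h1
  ext <;> simp <;> omega

theorem mem_range_hardyExp {n : Fin 2 → ℤ} (h0 : 0 ≤ n 0) (h1 : 0 ≤ n 0 + n 1 + 1) :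
    n ∈ range hardyExp := by
  refine ⟨((n 0).toNat, (n 0 + n 1 + 1).toNat), ?_⟩
  ext i
  fin_cases i
  · simp [hardyExp, h0]
  · simp [hardyExp, h0, h1]
    ring

theorem nonpos_of_forall_le_mul {x C : ℝ} (h : ∀ s ∈ Ioo (0 : ℝ) 1, x ≤ C * s) : x ≤ 0 := by
  have h1 : Tendsto (fun s : ℝ => C * s) (𝓝[>] 0) (𝓝 (C * 0)) :=
    ((continuous_const.mul continuous_id).tendsto 0).mono_left nhdsWithin_le_nhds
  rw [mul_zero] at h1
  exact ge_of_tendsto h1 (by filter_upwards [Ioo_mem_nhdsGT (zero_lt_one' ℝ)] using h)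

theorem mul_zpow_le_imp_zero {x C s : ℝ} (hx : 0 ≤ x) {k : ℤ} (hk : k < 0) (hs : s ∈ Ioo (0 : ℝ) 1)
    (h : x * s ^ k ≤ C) : x ≤ C * s := by
  have hs0 := hs.1
  have h1 : s ^ (-1 : ℤ) ≤ s ^ k := zpow_le_zpow_right_of_le_one₀ hs0 hs.2.le (by omega)
  have h2 : x * s ^ (-1 : ℤ) ≤ C := (mul_le_mul_of_nonneg_left h1 hx).trans h
  rw [zpow_neg_one, ← div_eq_mul_inv, div_le_iff₀ hs0] at h2
  exact h2

/-- The coefficient of `w⁻¹ (z / w) ^ i w ^ j` in the Laurent expansion of `f`. -/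
def hardyCoeff (f : ℂ × ℂ → ℂ) (p : ℕ × ℕ) : ℂ :=
  laurentCoeff f (1 / 4) (1 / 2) (hardyExp p 0) (hardyExp p 1)

theorem laurentCoeff_eq {f : ℂ × ℂ → ℂ} (hf : DifferentiableOn ℂ f hartogsTriangle)
    {s t : ℝ} (hs : s ∈ Ioo (0 : ℝ) 1) (ht : t ∈ Ioo (0 : ℝ) 1) (m n : ℤ) :
    laurentCoeff f (s * t) t m n = laurentCoeff f (1 / 4) (1 / 2) m n :=
  laurentCoeff_eq_of_radius hf (mul_pos hs.1 ht.1) (by nlinarith [hs.1, hs.2, ht.1]) ht.2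
    (by norm_num) (by norm_num) (by norm_num) m n

theorem hasSum_hardyCoeff {f : ℂ × ℂ → ℂ} (hf : f ∈ hardySubmodule) {s t : ℝ}
    (hs : s ∈ Ioo (0 : ℝ) 1) (ht : t ∈ Ioo (0 : ℝ) 1) :
    HasSum (fun p : ℕ × ℕ => ‖hardyCoeff f p‖ ^ 2 * (s ^ (2 * p.1 + 1) * t ^ (2 * p.2)))
      (hardyMean f s t) := by
  obtain ⟨hd, ⟨C, hC⟩, -⟩ := hf
  have key : ∀ s ∈ Ioo (0 : ℝ) 1, ∀ t ∈ Ioo (0 : ℝ) 1, HasSum (fun n : Fin 2 → ℤ =>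
      ‖laurentCoeff f (1 / 4) (1 / 2) (n 0) (n 1)‖ ^ 2 *
      (s ^ (2 * n 0 + 1) * t ^ (2 * (n 0 + n 1 + 1)))) (hardyMean f s t) := fun s hs t ht => by
    simpa only [laurentCoeff_eq hd hs ht] using hasSum_hardyMean hd.continuousOn hs ht
  have term : ∀ n : Fin 2 → ℤ, ∀ s ∈ Ioo (0 : ℝ) 1, ∀ t ∈ Ioo (0 : ℝ) 1,
      ‖laurentCoeff f (1 / 4) (1 / 2) (n 0) (n 1)‖ ^ 2 *
      (s ^ (2 * n 0 + 1) * t ^ (2 * (n 0 + n 1 + 1))) ≤ C := fun n s hs t ht =>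
    (le_hasSum (key s hs t ht) n fun m _ => by
      have := hs.1
      have := ht.1
      positivity).trans (hC s hs t ht)
  have half : (1 / 2 : ℝ) ∈ Ioo (0 : ℝ) 1 := by norm_num
  have hzero : ∀ n : Fin 2 → ℤ, n ∉ range hardyExp →
      laurentCoeff f (1 / 4) (1 / 2) (n 0) (n 1) = 0 := by
    intro n hn
    by_contra hne
    have hpos : 0 < ‖laurentCoeff f (1 / 4) (1 / 2) (n 0) (n 1)‖ ^ 2 := by positivity
    by_cases h0 : 0 ≤ n 0
    · have h1 : n 0 + n 1 + 1 < 0 := by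
        by_contra h1
        exact hn (mem_range_hardyExp h0 (not_lt.1 h1))
      have := nonpos_of_forall_le_mul (fun t ht => mul_zpow_le_imp_zero (C := C)
        (x := ‖laurentCoeff f (1 / 4) (1 / 2) (n 0) (n 1)‖ ^ 2 * (1 / 2 : ℝ) ^ (2 * n 0 + 1))
        (by positivity) (k := 2 * (n 0 + n 1 + 1)) (by omega) ht (by
          rw [mul_assoc]; exact term n _ half t ht))
      have h3 : 0 < ‖laurentCoeff f (1 / 4) (1 / 2) (n 0) (n 1)‖ ^ 2 * (1 / 2 : ℝ) ^ (2 * n 0 + 1) :=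
        by positivity
      linarith
    · have := nonpos_of_forall_le_mul (fun s hs => mul_zpow_le_imp_zero (C := C)
        (x := ‖laurentCoeff f (1 / 4) (1 / 2) (n 0) (n 1)‖ ^ 2 *
          (1 / 2 : ℝ) ^ (2 * (n 0 + n 1 + 1)))
        (by positivity) (k := 2 * n 0 + 1) (by omega) hs (by
          rw [mul_assoc, mul_comm ((1 / 2 : ℝ) ^ _)]; exact term n s hs _ half))
      have h3 : 0 < ‖laurentCoeff f (1 / 4) (1 / 2) (n 0) (n 1)‖ ^ 2 *
        (1 / 2 : ℝ) ^ (2 * (n 0 + n 1 + 1)) := by positivity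
      linarith
  have := (hardyExp_injective.hasSum_iff (fun n hn => by rw [hzero n hn]; simp)).2 (key s hs t ht)
  refine this.congr_fun fun p => ?_
  simp only [Function.comp_apply, hardyCoeff]
  congr 2
  simp only [hardyExp, Matrix.cons_val_zero, Matrix.cons_val_one]
  rw [← zpow_natCast]
  push_cast
  ring_nf

theorem sum_hardyCoeff_le {f : ℂ × ℂ → ℂ} (hf : f ∈ hardySubmodule) {C : ℝ}
    (hC : ∀ s ∈ Ioo (0 : ℝ) 1, ∀ t ∈ Ioo (0 : ℝ) 1, hardyMean f s t ≤ C) (F : Finset (ℕ × ℕ)) :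
    ∑ p ∈ F, ‖hardyCoeff f p‖ ^ 2 ≤ C := by
  have h1 : Tendsto (fun s : ℝ => ∑ p ∈ F, ‖hardyCoeff f p‖ ^ 2 *
      (s ^ (2 * p.1 + 1) * s ^ (2 * p.2))) (𝓝[<] 1) (𝓝 (∑ p ∈ F, ‖hardyCoeff f p‖ ^ 2 *
      ((1 : ℝ) ^ (2 * p.1 + 1) * 1 ^ (2 * p.2)))) :=
    (Continuous.tendsto (by fun_prop) 1).mono_left nhdsWithin_le_nhds
  simp only [one_pow, mul_one] at h1
  refine le_of_tendsto h1 ?_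
  filter_upwards [Ioo_mem_nhdsLT (zero_lt_one' ℝ)] with s hs
  have := hs.1
  exact (sum_le_hasSum F (fun p _ => by positivity) (hasSum_hardyCoeff hf hs hs)).trans (hC s hs s hs)

theorem summable_hardyCoeff {f : ℂ × ℂ → ℂ} (hf : f ∈ hardySubmodule) :
    Summable fun p => ‖hardyCoeff f p‖ ^ 2 := by
  obtain ⟨C, hC⟩ := hf.2.1
  exact summable_of_sum_le (fun _ => by positivity) (sum_hardyCoeff_le hf hC)

theorem hardyMean_le_tsum {f : ℂ × ℂ → ℂ} (hf : f ∈ hardySubmodule) {s t : ℝ}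
    (hs : s ∈ Ioo (0 : ℝ) 1) (ht : t ∈ Ioo (0 : ℝ) 1) :
    hardyMean f s t ≤ ∑' p, ‖hardyCoeff f p‖ ^ 2 := by
  refine hasSum_le (fun p => ?_) (hasSum_hardyCoeff hf hs ht) (summable_hardyCoeff hf).hasSum
  refine mul_le_of_le_one_right (by positivity) ?_
  exact mul_le_one₀ (pow_le_one₀ hs.1.le hs.2.le) (pow_nonneg ht.1.le _)
    (pow_le_one₀ ht.1.le ht.2.le)

theorem iSup_hardyMean {f : ℂ × ℂ → ℂ} (hf : f ∈ hardySubmodule) :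
    ⨆ r : Ioo (0 : ℝ) 1 × Ioo (0 : ℝ) 1, hardyMean f r.1 r.2 = ∑' p, ‖hardyCoeff f p‖ ^ 2 := by
  have half : (1 / 2 : ℝ) ∈ Ioo (0 : ℝ) 1 := by norm_num
  have : Nonempty (Ioo (0 : ℝ) 1 × Ioo (0 : ℝ) 1) := ⟨(⟨_, half⟩, ⟨_, half⟩)⟩
  refine le_antisymm (ciSup_le fun r => hardyMean_le_tsum hf r.1.2 r.2.2) ?_
  refine (summable_hardyCoeff hf).tsum_le_of_sum_le (sum_hardyCoeff_le hf fun s hs t ht => ?_)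
  exact le_ciSup (f := fun r : Ioo (0 : ℝ) 1 × Ioo (0 : ℝ) 1 => hardyMean f r.1 r.2)
    ⟨_, by rintro _ ⟨r, rfl⟩; exact hardyMean_le_tsum hf r.1.2 r.2.2⟩ (⟨s, hs⟩, ⟨t, ht⟩)

theorem eq_zero_of_hardyCoeff {f : ℂ × ℂ → ℂ} (hf : f ∈ hardySubmodule)
    (h : ∀ p, hardyCoeff f p = 0) : f = 0 := by
  have hd := hf.1
  have hmean : ∀ s ∈ Ioo (0 : ℝ) 1, ∀ t ∈ Ioo (0 : ℝ) 1, hardyMean f s t = 0 := by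
    intro s hs t ht
    have := hasSum_hardyCoeff hf hs ht
    simp only [h, norm_zero, ne_eq, OfNat.ofNat_ne_zero, not_false_eq_true, zero_pow,
      zero_mul] at this
    exact this.unique hasSum_zero
  have h1 : ∀ z w : ℂ, z ≠ 0 → (z, w) ∈ hartogsTriangle → f (z, w) = 0 := by
    intro z w hz hzw
    have hz0 : 0 < ‖z‖ := norm_pos_iff.2 hz
    have hw0 : 0 < ‖w‖ := hz0.trans hzw.1
    have hs : ‖z‖ / ‖w‖ ∈ Ioo (0 : ℝ) 1 := ⟨div_pos hz0 hw0, (div_lt_one hw0).2 hzw.1⟩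
    have ht : ‖w‖ ∈ Ioo (0 : ℝ) 1 := ⟨hw0, hzw.2⟩
    have h2 := hasSum_hardyMean hd.continuousOn hs ht
    rw [hmean _ hs _ ht, div_mul_cancel₀ _ hw0.ne',
      hasSum_zero_iff_of_nonneg (fun n => by positivity)] at h2
    have h3 : ∀ n, UnitAddTorus.mFourierCoeff
        (polarMap f hd.continuousOn ‖z‖ ‖w‖ hz0.le hzw.1 hzw.2) n = 0 := by
      intro n
      have h4 := congrFun h2 n
      simp only [Pi.zero_apply, mul_eq_zero, ne_eq, OfNat.ofNat_ne_zero, not_false_eq_true,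
        pow_eq_zero_iff, norm_eq_zero] at h4
      rw [mFourierCoeff_polarMap hd.continuousOn hz0 hzw.1 hzw.2]
      rcases h4 with h4 | h4 | h4
      · rw [h4, mul_zero]
      · exact absurd h4 (zpow_pos hs.1 _).ne'
      · exact absurd h4 (zpow_pos ht.1 _).ne'
    have h5 := UnitAddTorus.hasSum_mFourier_series_apply_of_summable
      (f := polarMap f hd.continuousOn ‖z‖ ‖w‖ hz0.le hzw.1 hzw.2)
      (by rw [show UnitAddTorus.mFourierCoeff _ = 0 from funext h3]; exact summable_zero)
      (fun i => ((![arg z / (2 * Real.pi), arg w / (2 * Real.pi)] i : ℝ) : UnitAddCircle))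
    simp only [h3, zero_smul] at h5
    have h6 := h5.unique hasSum_zero
    have hpi : (2 * Real.pi) ≠ 0 := by positivity
    simpa only [polarMap, ContinuousMap.coe_mk, fourier_two_pi, zpow_one, Matrix.cons_val_zero,
      Matrix.cons_val_one, mul_div_cancel₀ _ hpi, norm_mul_exp_arg_mul_I] using h6
  ext ⟨z, w⟩
  by_cases hzw : (z, w) ∈ hartogsTriangle
  · by_cases hz : z = 0
    · subst hz
      have hc : ContinuousAt (fun z : ℂ => f (z, w)) 0 :=
        (hd.continuousOn.continuousAt (isOpen_hartogsTriangle.mem_nhds hzw)).comp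
          (f := fun z : ℂ => (z, w)) (by fun_prop)
      have h7 : ∀ᶠ z : ℂ in 𝓝[≠] 0, f (z, w) = 0 := by
        have : ∀ᶠ z : ℂ in 𝓝 0, (z, w) ∈ hartogsTriangle :=
          (isOpen_hartogsTriangle.preimage
            (by fun_prop : Continuous fun z : ℂ => (z, w))).mem_nhds hzw
        filter_upwards [self_mem_nhdsWithin, nhdsWithin_le_nhds this] with z hz hzw
        exact h1 z w hz hzw
      exact tendsto_nhds_unique (hc.tendsto.mono_left nhdsWithin_le_nhds)
        (tendsto_const_nhds.congr' (h7.mono fun z hz => hz.symm))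
    · exact h1 z w hz hzw
  · exact hf.2.2 _ hzw

/-- The sum of the power series with coefficients `A` at `q = (u, v)`. -/
def bidiscSeries (A : ℕ × ℕ → ℂ) (q : ℂ × ℂ) : ℂ := ∑' p : ℕ × ℕ, A p * (q.1 ^ p.1 * q.2 ^ p.2)

theorem summable_geom_prod {a b : ℝ} (ha : 0 ≤ a) (ha1 : a < 1) (hb : 0 ≤ b) (hb1 : b < 1) :
    Summable fun p : ℕ × ℕ => a ^ p.1 * b ^ p.2 :=
  (summable_geometric_of_lt_one ha ha1).mul_of_nonneg (summable_geometric_of_lt_one hb hb1)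
    (fun _ => pow_nonneg ha _) (fun _ => pow_nonneg hb _)

theorem summable_bidiscSeries {A : ℕ × ℕ → ℂ} {B : ℝ} (hA : ∀ p, ‖A p‖ ≤ B) {q : ℂ × ℂ}
    (h1 : ‖q.1‖ < 1) (h2 : ‖q.2‖ < 1) : Summable fun p : ℕ × ℕ => ‖A p * (q.1 ^ p.1 * q.2 ^ p.2)‖ := by
  refine Summable.of_nonneg_of_le (fun _ => norm_nonneg _) (fun p => ?_)
    ((summable_geom_prod (norm_nonneg q.1) h1 (norm_nonneg q.2) h2).mul_left B)
  rw [norm_mul, norm_mul, norm_pow, norm_pow]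
  exact mul_le_mul_of_nonneg_right (hA p) (by positivity)

theorem differentiableAt_bidiscSeries {A : ℕ × ℕ → ℂ} {B : ℝ} (hA : ∀ p, ‖A p‖ ≤ B) {q : ℂ × ℂ}
    (h1 : ‖q.1‖ < 1) (h2 : ‖q.2‖ < 1) : DifferentiableAt ℂ (bidiscSeries A) q := by
  have hB : 0 ≤ B := (norm_nonneg _).trans (hA 0)
  obtain ⟨ρ, hρ, hρ1⟩ := exists_between (max_lt h1 h2)
  have hρ0 : 0 < ρ := ((norm_nonneg _).trans (le_max_left _ _)).trans_lt hρ
  have hg : Summable fun n : ℕ => ρ ^ n := summable_geometric_of_lt_one hρ0.le hρ1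
  have hng : Summable fun n : ℕ => (n : ℝ) * ρ ^ (n - 1) := by
    rw [← summable_nat_add_iff 1]
    have := (summable_pow_mul_geometric_of_norm_lt_one (R := ℝ) 1 (r := ρ)
      (by rwa [Real.norm_of_nonneg hρ0.le])).add hg
    refine this.congr fun n => ?_
    simp
    ring
  have hu : Summable fun p : ℕ × ℕ => B * (ρ ^ p.1 * (p.2 * ρ ^ (p.2 - 1)) +
      (p.1 * ρ ^ (p.1 - 1)) * ρ ^ p.2) :=
    ((hg.mul_of_nonneg hng (fun _ => by positivity) (fun _ => by positivity)).add
      (hng.mul_of_nonneg hg (fun _ => by positivity) (fun _ => by positivity))).mul_left B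
  have hball : ∀ x : ℂ × ℂ, x ∈ Metric.ball (0 : ℂ × ℂ) ρ → ‖x.1‖ < ρ ∧ ‖x.2‖ < ρ := by
    intro x hx
    rw [mem_ball_zero_iff, Prod.norm_def] at hx
    exact max_lt_iff.1 hx
  refine (hasFDerivAt_tsum_of_isPreconnected
    (f' := fun p x => A p • (x.1 ^ p.1 • (((p.2 : ℂ) * x.2 ^ (p.2 - 1)) • ContinuousLinearMap.snd ℂ ℂ ℂ) +
      x.2 ^ p.2 • (((p.1 : ℂ) * x.1 ^ (p.1 - 1)) • ContinuousLinearMap.fst ℂ ℂ ℂ))) hu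
    Metric.isOpen_ball (convex_ball (0 : ℂ × ℂ) ρ).isPreconnected ?_ ?_ (Metric.mem_ball_self hρ0)
    ?_ (by rw [mem_ball_zero_iff]; exact hρ)).differentiableAt
  · intro p x _
    refine HasFDerivAt.const_mul ?_ _
    refine HasFDerivAt.mul ?_ ?_
    · exact (hasDerivAt_pow p.1 x.1).comp_hasFDerivAt x hasFDerivAt_fst
    · exact (hasDerivAt_pow p.2 x.2).comp_hasFDerivAt x hasFDerivAt_snd
  · intro p x hx
    obtain ⟨hx1, hx2⟩ := hball x hx
    rw [norm_smul]
    refine mul_le_mul (hA p) ((norm_add_le _ _).trans (add_le_add ?_ ?_)) (norm_nonneg _) hB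
    · rw [norm_smul, norm_smul, norm_pow, norm_mul, norm_pow, Complex.norm_natCast]
      have := ContinuousLinearMap.norm_snd_le ℂ ℂ ℂ
      calc _ ≤ ρ ^ p.1 * (p.2 * ρ ^ (p.2 - 1) * 1) := by gcongr
        _ = _ := by ring
    · rw [norm_smul, norm_smul, norm_pow, norm_mul, norm_pow, Complex.norm_natCast]
      have := ContinuousLinearMap.norm_fst_le ℂ ℂ ℂ
      calc _ ≤ ρ ^ p.2 * (p.1 * ρ ^ (p.1 - 1) * 1) := by gcongr
        _ = _ := by ring
  · exact (summable_bidiscSeries (q := 0) hA (by simp) (by simp)).of_norm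

open Classical in
/-- The function `∑ A i j w⁻¹ (z / w) ^ i w ^ j` on the triangle, extended by zero. -/
def hartogsSeries (A : ℕ × ℕ → ℂ) (q : ℂ × ℂ) : ℂ :=
  if q ∈ hartogsTriangle then q.2⁻¹ * bidiscSeries A (q.1 / q.2, q.2) else 0

theorem snd_ne_zero {q : ℂ × ℂ} (hq : q ∈ hartogsTriangle) : q.2 ≠ 0 :=
  norm_pos_iff.1 ((norm_nonneg _).trans_lt hq.1)

theorem norm_div_lt_one {q : ℂ × ℂ} (hq : q ∈ hartogsTriangle) : ‖q.1 / q.2‖ < 1 := by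
  rw [norm_div, div_lt_one (norm_pos_iff.2 (snd_ne_zero hq))]
  exact hq.1

theorem differentiableOn_hartogsSeries {A : ℕ × ℕ → ℂ} {B : ℝ} (hA : ∀ p, ‖A p‖ ≤ B) :
    DifferentiableOn ℂ (hartogsSeries A) hartogsTriangle := by
  have : DifferentiableOn ℂ (fun q : ℂ × ℂ => q.2⁻¹ * bidiscSeries A (q.1 / q.2, q.2))
      hartogsTriangle := by
    intro q hq
    have h0 := snd_ne_zero hq
    refine DifferentiableAt.differentiableWithinAt ?_
    refine DifferentiableAt.mul (by fun_prop (disch := assumption)) ?_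
    exact (differentiableAt_bidiscSeries (q := (q.1 / q.2, q.2)) hA (norm_div_lt_one hq) hq.2).comp
      (f := fun q : ℂ × ℂ => (q.1 / q.2, q.2)) q
      (by fun_prop (disch := assumption))
  exact this.congr fun q hq => if_pos hq

theorem laurentCoeff_hartogsSeries {A : ℕ × ℕ → ℂ} {B : ℝ} (hA : ∀ p, ‖A p‖ ≤ B) {s t : ℝ}
    (hs : s ∈ Ioo (0 : ℝ) 1) (ht : t ∈ Ioo (0 : ℝ) 1) (n : Fin 2 → ℤ) :
    HasSum (fun p : ℕ × ℕ => A p * if n = hardyExp p then 1 else 0)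
      (laurentCoeff (hartogsSeries A) (s * t) t (n 0) (n 1)) := by
  have hr : 0 < s * t := mul_pos hs.1 ht.1
  have hrt : s * t < t := by nlinarith [hs.1, hs.2, ht.1]
  have hs0 : (s : ℂ) ≠ 0 := by exact_mod_cast hs.1.ne'
  have ht0 : (t : ℂ) ≠ 0 := by exact_mod_cast ht.1.ne'
  have hc := (differentiableOn_hartogsSeries hA).continuousOn
  set P := polarMap (hartogsSeries A) hc (s * t) t hr.le hrt ht.2 with hP
  let c : ℕ × ℕ → ℂ := fun p => (t : ℂ)⁻¹ * (A p * ((s : ℂ) ^ p.1 * (t : ℂ) ^ p.2))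
  have hcs : Summable fun p => c p • UnitAddTorus.mFourier (hardyExp p) := by
    refine Summable.of_norm ?_
    simp only [norm_smul, UnitAddTorus.mFourier_norm, mul_one]
    simp only [c]
    simp only [norm_mul (t : ℂ)⁻¹]
    exact (summable_bidiscSeries (q := ((s : ℂ), (t : ℂ))) hA (by simpa [abs_of_pos hs.1] using hs.2)
      (by simpa [abs_of_pos ht.1] using ht.2)).mul_left _
  have hsum : HasSum (fun p => c p • UnitAddTorus.mFourier (hardyExp p)) P := by
    convert! hcs.hasSum
    ext x
    have h1 := ((ContinuousMap.evalCLM ℂ x).hasSum hcs.hasSum).tsum_eq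
    refine Eq.trans ?_ h1
    have hx : ∀ y : UnitAddCircle, ‖fourier 1 y‖ = 1 := fun y => by
      rw [fourier_apply]; exact Circle.norm_coe _
    have hmem : ((((s * t : ℝ) : ℂ)) * fourier 1 (x 0), (t : ℂ) * fourier 1 (x 1)) ∈
        hartogsTriangle := by
      simp only [hartogsTriangle, mem_ofPred_eq, norm_mul _ (fourier 1 _), hx, norm_real,
        Real.norm_eq_abs, abs_of_pos hr, abs_of_pos ht.1, mul_one]
      exact ⟨hrt, ht.2⟩
    have h0 : ∀ y : UnitAddCircle, fourier 1 y ≠ 0 := fun y =>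
      norm_pos_iff.1 (by rw [hx]; exact one_pos)
    have hpow : ∀ (k : ℤ) (y : UnitAddCircle), fourier k y = fourier 1 y ^ k := fun k y => by
      induction y using QuotientAddGroup.induction_on with
      | H z => exact (fourier_two_pi z k).trans (by rw [fourier_two_pi z 1, zpow_one])
    simp only [hP, polarMap, ContinuousMap.coe_mk, hartogsSeries, if_pos hmem, bidiscSeries]
    rw [← tsum_mul_left]
    refine tsum_congr fun p => ?_
    change _ = c p * UnitAddTorus.mFourier (hardyExp p) x
    simp only [c, UnitAddTorus.mFourier, ContinuousMap.coe_mk, Fin.prod_univ_two,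
      hardyExp, Matrix.cons_val_zero, Matrix.cons_val_one]
    rw [hpow p.1, hpow (p.2 - p.1 - 1), zpow_sub₀ (h0 _), zpow_sub₀ (h0 _), zpow_natCast, zpow_natCast, zpow_natCast, zpow_one,
      ofReal_mul]
    have := h0 (x 0)
    have := h0 (x 1)
    rw [mul_right_comm (s : ℂ), mul_comm _ (t : ℂ), mul_div_mul_left _ _ ht0, div_pow, mul_pow, mul_pow]
    field_simp
  have hL := ((innerSL ℂ (UnitAddTorus.mFourierLp 2 n)).comp
    (ContinuousMap.toLp (E := ℂ) 2 (Measure.pi fun _ : Fin 2 => AddCircle.haarAddCircle (T := 1)) ℂ)).hasSum hsum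
  have hLP : ((innerSL ℂ (UnitAddTorus.mFourierLp 2 n)).comp
    (ContinuousMap.toLp (E := ℂ) 2 (Measure.pi fun _ : Fin 2 => AddCircle.haarAddCircle (T := 1)) ℂ)) P =
      UnitAddTorus.mFourierCoeff P n := by
    have h1 := (UnitAddTorus.mFourierBasis_repr (ContinuousMap.toLp (E := ℂ) 2 (Measure.pi fun _ : Fin 2 => AddCircle.haarAddCircle (T := 1)) ℂ P) n).trans (UnitAddTorus.mFourierCoeff_toLp P n)
    rw [HilbertBasis.repr_apply_apply, UnitAddTorus.coe_mFourierBasis] at h1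
    exact h1
  rw [hLP, hP, mFourierCoeff_polarMap hc hr hrt ht.2] at hL
  have hne : ((s * t : ℝ) : ℂ) ^ n 0 * (t : ℂ) ^ n 1 ≠ 0 := by
    have : ((s * t : ℝ) : ℂ) ≠ 0 := by exact_mod_cast hr.ne'
    exact mul_ne_zero (zpow_ne_zero _ this) (zpow_ne_zero _ ht0)
  have h2 := hL.mul_left (((s * t : ℝ) : ℂ) ^ n 0 * (t : ℂ) ^ n 1)⁻¹
  rw [inv_mul_cancel_left₀ hne] at h2
  refine h2.congr_fun fun p => ?_
  have ho := (orthonormal_iff_ite.1 (UnitAddTorus.orthonormal_mFourier (d := Fin 2))) n (hardyExp p)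
  have e : ((innerSL ℂ (UnitAddTorus.mFourierLp 2 n)).comp
    (ContinuousMap.toLp (E := ℂ) 2 (Measure.pi fun _ : Fin 2 => AddCircle.haarAddCircle (T := 1)) ℂ))
      (c p • UnitAddTorus.mFourier (hardyExp p)) = c p * if n = hardyExp p then 1 else 0 := by
    rw [map_smul, smul_eq_mul]
    exact congrArg _ ho
  refine Eq.trans ?_ (congrArg _ e.symm)
  split_ifs with h
  · subst h
    simp only [c, hardyExp, Matrix.cons_val_zero, Matrix.cons_val_one]
    rw [zpow_sub₀ ht0, zpow_sub₀ ht0, zpow_natCast, zpow_natCast, zpow_natCast, zpow_one, ofReal_mul,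
      mul_pow]
    field_simp
  · simp

theorem hardyCoeff_hartogsSeries {A : ℕ × ℕ → ℂ} {B : ℝ} (hA : ∀ p, ‖A p‖ ≤ B) (p : ℕ × ℕ) :
    hardyCoeff (hartogsSeries A) p = A p := by
  have half : (1 / 2 : ℝ) ∈ Ioo (0 : ℝ) 1 := by norm_num
  have h := laurentCoeff_hartogsSeries hA half half (hardyExp p)
  rw [laurentCoeff_eq (differentiableOn_hartogsSeries hA) half half] at h
  have h1 := hasSum_single (f := fun q => A q * if hardyExp p = hardyExp q then (1 : ℂ) else 0) p
    fun q hq => by rw [if_neg fun h => hq (hardyExp_injective h).symm, mul_zero]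
  rw [if_pos rfl, mul_one] at h1
  exact h.unique h1

theorem hartogsSeries_mem {A : ℕ × ℕ → ℂ} (hA : Summable fun p => ‖A p‖ ^ 2) :
    hartogsSeries A ∈ hardySubmodule := by
  have hB : ∀ p, ‖A p‖ ≤ √(∑' p, ‖A p‖ ^ 2) := fun p =>
    Real.le_sqrt_of_sq_le (hA.le_tsum p fun _ _ => by positivity)
  have hd := differentiableOn_hartogsSeries hB
  refine ⟨hd, ⟨∑' p, ‖A p‖ ^ 2, fun s hs t ht => ?_⟩, fun p hp => if_neg hp⟩
  have h := hasSum_hardyMean hd.continuousOn hs ht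
  have hz : ∀ n : Fin 2 → ℤ, n ∉ range hardyExp →
      laurentCoeff (hartogsSeries A) (s * t) t (n 0) (n 1) = 0 := fun n hn =>
    (laurentCoeff_hartogsSeries hB hs ht n).unique (hasSum_zero.congr_fun fun p => by
      rw [if_neg fun h => hn ⟨p, h.symm⟩, mul_zero])
  rw [← hardyExp_injective.hasSum_iff (fun n hn => by rw [hz n hn]; simp)] at h
  refine hasSum_le (fun p => ?_) h hA.hasSum
  simp only [Function.comp_apply]
  rw [laurentCoeff_eq hd hs ht, ← hardyCoeff, hardyCoeff_hartogsSeries hB]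
  refine mul_le_of_le_one_right (by positivity) ?_
  have e1 : 2 * hardyExp p 0 + 1 = ((2 * p.1 + 1 : ℕ) : ℤ) := by simp [hardyExp]
  have e2 : 2 * (hardyExp p 0 + hardyExp p 1 + 1) = ((2 * p.2 : ℕ) : ℤ) := by
    simp [hardyExp]
    ring
  rw [e1, e2, zpow_natCast, zpow_natCast]
  exact mul_le_one₀ (pow_le_one₀ hs.1.le hs.2.le) (pow_nonneg ht.1.le _)
    (pow_le_one₀ ht.1.le ht.2.le)

/-- The Hardy space `H²` of the Hartogs triangle as a type; the instances below make it a Hilbert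
space. -/
def HardySpace : Type := hardySubmodule

namespace HardySpace

instance : AddCommGroup HardySpace := inferInstanceAs (AddCommGroup hardySubmodule)

instance : Module ℂ HardySpace := inferInstanceAs (Module ℂ hardySubmodule)

/-- The underlying function of an element of `H²`. -/
def toFun (f : HardySpace) : ℂ × ℂ → ℂ := (show hardySubmodule from f).1

instance : CoeFun HardySpace fun _ => ℂ × ℂ → ℂ := ⟨toFun⟩

/-- The element of `H²` given by a function with the defining properties. -/
def ofMem (f : ℂ × ℂ → ℂ) (hf : f ∈ hardySubmodule) : HardySpace :=
  (⟨f, hf⟩ : hardySubmodule)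

theorem mem (f : HardySpace) : f.toFun ∈ hardySubmodule := Subtype.property _

theorem ext {f g : HardySpace} (h : ∀ p ∈ hartogsTriangle, f p = g p) : f = g :=
  Subtype.ext <| funext fun p => by
    by_cases hp : p ∈ hartogsTriangle
    · exact h p hp
    · exact (f.mem.2.2 p hp).trans (g.mem.2.2 p hp).symm

theorem add_apply (f g : HardySpace) (p : ℂ × ℂ) : (f + g) p = f p + g p := rfl

theorem smul_apply (c : ℂ) (f : HardySpace) (p : ℂ × ℂ) : (c • f) p = c * f p := rfl

/-- The Hardy norm: `‖f‖²` is the supremum of the means `hardyMean f s t` over `0 < s, t < 1`. -/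
instance : Norm HardySpace :=
  ⟨fun f => √(⨆ r : Ioo (0 : ℝ) 1 × Ioo (0 : ℝ) 1, hardyMean f r.1 r.2)⟩

theorem norm_def (f : HardySpace) :
    ‖f‖ = √(⨆ r : Ioo (0 : ℝ) 1 × Ioo (0 : ℝ) 1, hardyMean f r.1 r.2) := rfl

theorem memℓp_hardyCoeff (f : HardySpace) : Memℓp (E := fun _ : ℕ × ℕ => ℂ) (hardyCoeff f) 2 :=
  (memℓp_gen_iff (by norm_num)).2 (by simpa using summable_hardyCoeff f.mem)

/-- The coefficients of `f` with respect to the monomials `w⁻¹ (z / w) ^ i w ^ j`. -/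
def coeffMap : HardySpace →ₗ[ℂ] lp (fun _ : ℕ × ℕ => ℂ) 2 where
  toFun f := ⟨hardyCoeff f, memℓp_hardyCoeff f⟩
  map_add' f g := lp.ext <| funext fun p =>
    laurentCoeff_add f.mem.1.continuousOn g.mem.1.continuousOn (by norm_num) (by norm_num)
      (by norm_num) _ _
  map_smul' c f := lp.ext <| funext fun p => laurentCoeff_smul c f _ _ _ _

theorem coeffMap_apply (f : HardySpace) (p : ℕ × ℕ) : coeffMap f p = hardyCoeff f p := rfl

theorem coeffMap_bijective : Function.Bijective coeffMap := by
  constructor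
  · rw [← LinearMap.ker_eq_bot, LinearMap.ker_eq_bot']
    intro f hf
    have h := eq_zero_of_hardyCoeff f.mem fun p => by rw [← coeffMap_apply, hf]; rfl
    exact ext fun p _ => congrFun h p
  · intro A
    have hA : Summable fun p => ‖A p‖ ^ 2 := by
      simpa using (memℓp_gen_iff (by norm_num)).1 A.2
    exact ⟨ofMem _ (hartogsSeries_mem hA), lp.ext <| funext fun p =>
      hardyCoeff_hartogsSeries (B := ‖A‖) (fun p => lp.norm_apply_le_norm (by norm_num) A p) p⟩

theorem norm_coeffMap (f : HardySpace) : ‖coeffMap f‖ = ‖f‖ := by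
  rw [norm_def, iSup_hardyMean f.mem]
  have h := lp.norm_rpow_eq_tsum (p := 2) (by norm_num) (coeffMap f)
  simp only [ENNReal.toReal_ofNat, Real.rpow_ofNat, coeffMap_apply] at h
  rw [← h, Real.sqrt_sq (norm_nonneg _)]

theorem normedSpaceCore : NormedSpace.Core ℂ HardySpace where
  norm_nonneg f := Real.sqrt_nonneg _
  norm_smul c f := by rw [← norm_coeffMap, ← norm_coeffMap, map_smul, norm_smul]
  norm_triangle f g := by
    simp only [← norm_coeffMap, map_add]
    exact norm_add_le _ _
  norm_eq_zero_iff f := by rw [← norm_coeffMap, norm_eq_zero, map_eq_zero_iff _ coeffMap_bijective.1]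

instance : NormedAddCommGroup HardySpace := NormedAddCommGroup.ofCore normedSpaceCore

instance : NormedSpace ℂ HardySpace := NormedSpace.ofCore normedSpaceCore

/-- The inner product of `H²`, obtained from the Hardy norm by polarization. -/
instance : InnerProductSpace ℂ HardySpace := InnerProductSpace.ofNorm ℂ fun f g => by
  have := parallelogram_law_with_norm ℂ (coeffMap f) (coeffMap g)
  rwa [← map_add, ← map_sub, norm_coeffMap, norm_coeffMap, norm_coeffMap,
    norm_coeffMap, pow_two, pow_two, pow_two, pow_two] at this

instance : CompleteSpace HardySpace :=
  let e : HardySpace ≃ₗᵢ[ℂ] lp (fun _ : ℕ × ℕ => ℂ) 2 := 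
    ⟨LinearEquiv.ofBijective coeffMap coeffMap_bijective, norm_coeffMap⟩
  e.symm.isometry.isUniformInducing.completeSpace_congr e.symm.surjective |>.1 inferInstance

end HardySpace

theorem hardyMean_mul_le {f φ : ℂ × ℂ → ℂ} (hf : ContinuousOn f hartogsTriangle)
    (hφ : ContinuousOn φ hartogsTriangle) (hb : ∀ p ∈ hartogsTriangle, ‖φ p‖ ≤ 1)
    {s t : ℝ} (hs : s ∈ Ioo (0 : ℝ) 1) (ht : t ∈ Ioo (0 : ℝ) 1) :
    hardyMean (fun p => φ p * f p) s t ≤ hardyMean f s t := by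
  have hr : 0 < s * t := mul_pos hs.1 ht.1
  have hrt : s * t < t := by nlinarith [hs.1, hs.2, ht.1]
  have hs0 := hs.1
  have hcont : ∀ {g : ℂ × ℂ → ℂ}, ContinuousOn g hartogsTriangle → Continuous fun x : ℝ × ℝ =>
      ‖g (s * t * exp (x.1 * I), t * exp (x.2 * I))‖ ^ 2 * (s * t ^ 2) := fun hg => by
    have := continuous_polar hg hr.le hrt ht.2
    rw [ofReal_mul] at this
    exact (this.norm.pow 2).mul continuous_const
  have h1 := hcont (hφ.mul hf)
  have h2 := hcont hf
  refine mul_le_mul_of_nonneg_left ?_ (by positivity)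
  refine intervalIntegral.integral_mono_on Real.two_pi_pos.le
    ((intervalIntegral.continuous_parametric_intervalIntegral_of_continuous' h1
      _ _).intervalIntegrable _ _)
    ((intervalIntegral.continuous_parametric_intervalIntegral_of_continuous' h2
      _ _).intervalIntegrable _ _) fun a _ => ?_
  refine intervalIntegral.integral_mono_on Real.two_pi_pos.le
    ((h1.comp (by fun_prop : Continuous fun b : ℝ => (a, b))).intervalIntegrable _ _)
    ((h2.comp (by fun_prop : Continuous fun b : ℝ => (a, b))).intervalIntegrable _ _) fun b _ => ?_
  have hm := mem_hartogsTriangle_polar hr.le hrt ht.2 a b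
  rw [ofReal_mul] at hm
  refine mul_le_mul_of_nonneg_right (pow_le_pow_left₀ (norm_nonneg _) ?_ 2) (by positivity)
  rw [norm_mul]
  exact mul_le_of_le_one_left (norm_nonneg _) (hb _ hm)

/-- Multiplication by a holomorphic function `φ` with `|φ| ≤ 1` on the triangle. -/
def mulOp (φ : ℂ × ℂ → ℂ) (hφ : DifferentiableOn ℂ φ hartogsTriangle)
    (hb : ∀ p ∈ hartogsTriangle, ‖φ p‖ ≤ 1) : HardySpace →L[ℂ] HardySpace :=
  LinearMap.mkContinuous
    { toFun := fun f => .ofMem (fun p => φ p * f p) ⟨hφ.mul f.mem.1,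
        f.mem.2.1.imp fun _ hC s hs t ht => (hardyMean_mul_le f.mem.1.continuousOn hφ.continuousOn
          hb hs ht).trans (hC s hs t ht),
        fun p hp => mul_eq_zero_of_right _ (f.mem.2.2 p hp)⟩
      map_add' := fun f g => HardySpace.ext fun p _ => mul_add _ _ _
      map_smul' := fun c f => HardySpace.ext fun p _ => mul_left_comm _ _ _ } 1 fun f => by
    rw [one_mul]
    refine Real.sqrt_le_sqrt (ciSup_mono ?_ fun r => ?_)
    · obtain ⟨C, hC⟩ := f.mem.2.1
      exact ⟨C, by rintro _ ⟨r, rfl⟩; exact hC _ r.1.2 _ r.2.2⟩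
    · exact hardyMean_mul_le f.mem.1.continuousOn hφ.continuousOn hb r.1.2 r.2.2

/-- `M_z`, multiplication by the first coordinate. -/
def Mz : HardySpace →L[ℂ] HardySpace :=
  mulOp Prod.fst differentiableOn_fst fun _ hp => (hp.1.trans hp.2).le

/-- `M_w`, multiplication by the second coordinate. -/
def Mw : HardySpace →L[ℂ] HardySpace :=
  mulOp Prod.snd differentiableOn_snd fun _ hp => hp.2.le

/-- A quotient module of `H²`: a closed subspace that is invariant under `M_z*` and `M_w*`. -/
structure QuotientModule where
  toSubmodule : Submodule ℂ HardySpace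
  isClosed : IsClosed (toSubmodule : Set HardySpace)
  adjoint_Mz_mem : ∀ f ∈ toSubmodule, ContinuousLinearMap.adjoint Mz f ∈ toSubmodule
  adjoint_Mw_mem : ∀ f ∈ toSubmodule, ContinuousLinearMap.adjoint Mw f ∈ toSubmodule

instance (Q : QuotientModule) : CompleteSpace Q.toSubmodule := Q.isClosed.completeSpace_coe

/-- The compression `P_Q T|_Q` of an operator `T` to `Q`. -/
def QuotientModule.compression (Q : QuotientModule) (T : HardySpace →L[ℂ] HardySpace) :
    Q.toSubmodule →L[ℂ] Q.toSubmodule :=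
  Q.toSubmodule.orthogonalProjectionOnto ∘L T ∘L Q.toSubmodule.subtypeL

/-- `Q` is doubly commuting if `[Q_z*, Q_w] = 0` for the compressions `Q_z`, `Q_w` of `M_z`, `M_w`. -/
def QuotientModule.IsDoublyCommuting (Q : QuotientModule) : Prop :=
  ContinuousLinearMap.adjoint (Q.compression Mz) ∘L Q.compression Mw -
    Q.compression Mw ∘L ContinuousLinearMap.adjoint (Q.compression Mz) = 0

/-- The subspace `θ H²` of all products `θ f` with `f ∈ H²` (that lie in `H²`, which is automatic for
bounded holomorphic `θ`). -/
def multiples (θ : ℂ × ℂ → ℂ) : Submodule ℂ HardySpace where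
  carrier := {g | ∃ f : HardySpace, ∀ p ∈ hartogsTriangle, g p = θ p * f p}
  add_mem' := by
    rintro _ _ ⟨f, hf⟩ ⟨g, hg⟩
    refine ⟨f + g, fun p hp => ?_⟩
    rw [HardySpace.add_apply, HardySpace.add_apply, hf p hp, hg p hp, mul_add]
  zero_mem' := ⟨0, fun p _ => (mul_zero _).symm⟩
  smul_mem' := by
    rintro c _ ⟨f, hf⟩
    refine ⟨c • f, fun p hp => ?_⟩
    rw [HardySpace.smul_apply, HardySpace.smul_apply, hf p hp, mul_left_comm]

theorem mulOp_mem_multiples (θ : ℂ × ℂ → ℂ) {φ : ℂ × ℂ → ℂ}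
    (hφ : DifferentiableOn ℂ φ hartogsTriangle) (hb : ∀ p ∈ hartogsTriangle, ‖φ p‖ ≤ 1)
    {g : HardySpace} (hg : g ∈ multiples θ) : mulOp φ hφ hb g ∈ multiples θ := by
  obtain ⟨f, hf⟩ := hg
  refine ⟨mulOp φ hφ hb f, fun p hp => ?_⟩
  change φ p * g p = θ p * (φ p * f p)
  rw [hf p hp, mul_left_comm]

theorem adjoint_mem_orthogonal {S : Submodule ℂ HardySpace} {T : HardySpace →L[ℂ] HardySpace}
    (hT : ∀ g ∈ S, T g ∈ S) {f : HardySpace} (hf : f ∈ Sᗮ) :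
    ContinuousLinearMap.adjoint T f ∈ Sᗮ := by
  intro g hg
  rw [ContinuousLinearMap.adjoint_inner_right]
  exact hf _ (hT g hg)

/-- The quotient module `H² ⊖ θ H²`. -/
def quotientModule (θ : ℂ × ℂ → ℂ) : QuotientModule where
  toSubmodule := (multiples θ)ᗮ
  isClosed := Submodule.isClosed_orthogonal _
  adjoint_Mz_mem _ hf := adjoint_mem_orthogonal (fun _ hg => mulOp_mem_multiples θ _ _ hg) hf
  adjoint_Mw_mem _ hf := adjoint_mem_orthogonal (fun _ hg => mulOp_mem_multiples θ _ _ hg) hf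

/-- `θ` is an inner function on the unit disc (its values outside the disc are irrelevant):
holomorphic, bounded by one, with radial limits of modulus one almost everywhere on the circle. -/
structure IsInner (θ : ℂ → ℂ) : Prop where
  differentiableOn : DifferentiableOn ℂ θ (Metric.ball 0 1)
  norm_le_one : ∀ z ∈ Metric.ball (0 : ℂ) 1, ‖θ z‖ ≤ 1
  radial_limit : ∀ᵐ t : ℝ, ∃ ζ : ℂ, ‖ζ‖ = 1 ∧
    Tendsto (fun r : ℝ => θ (r * exp (t * I))) (𝓝[<] 1) (𝓝 ζ)

end Hartogs

end

open Complex MeasureTheory Set Filter Topology ComplexConjugate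

namespace Hartogs

/-! The functions e_{ij} = w⁻¹ (z/w)^i w^j form an orthonormal basis, so the space is a copy of the
Hardy space of the bidisc in the variables z/w and w. Write U for multiplication by z/w (`divOp`)
and V for `Mw`. These shift i and j respectively, U* and V* commute with the shift in the other
variable, and `Mz` = UV. Let A and B be multiplication by θ₁(z/w) and θ₂(w). They act as analytic
Toeplitz operators in one index each, and innerness enters through the relations ∑ conj(a_n) a_{n+k}
= δ_{k0} for Taylor coefficients (`IsInner.hasSum_conj_taylorCoeff`), which give A*A e_{0k} = e_{0k}
and B*B e_{k0} = e_{k0}.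

Necessity comes from applying the commutator to two vectors of the quotient module Q. It contains
ker (AB)*, and the adjoint of a compression is the restriction of the adjoint. The vector U*A e_{00}
and its image under V both lie in Q, while `Mz`* kills U*A e_{00}; double commutativity then gives
(U*)² A e_{00} = 0, so θ₁ is affine (`taylorCoeff_fst_eq_zero`). Orthogonality of θ₁ and zθ₁ leaves
only constants and rotations (`IsInner.const_or_rotation`).

For θ₂ with coefficients b_n, the vector U V* B e_{00} is used. Since e_{10} is in the range of A in
both remaining cases, the commutator identity becomes |b_0|² V* B e_{00} = P_Q (V* B e_{00} - b_1
e_{00}) (`IsDoublyCommuting.adjoint_Mw_eq`). If θ₁ is a rotation, the right side needs no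
projection, and either |b_0| = 1 or θ₂ is affine. If θ₁ is constant, the projection of e_{00} is
e_{00} - conj(b_0) B e_{00}, and comparing coefficients gives a first-order recurrence whose
nonconstant inner solutions are the disc automorphisms up to rotation
(`IsInner.blaschke_of_taylorCoeff`).

Sufficiency is immediate: in cases (i), (iii) and (iv) z H² lies in θ₁θ₂ H², so Q_z = 0; in case
(ii) (w - b) H² does, so Q_w is the scalar b. -/

/-! ### Fourier series on the circle -/

theorem integral_exp_pow_mul_conj_pow (m n : ℕ) :
    ∫ t in (0 : ℝ)..(2 * Real.pi), exp (t * I) ^ n * conj (exp (t * I)) ^ m =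
      if n = m then (2 * Real.pi : ℂ) else 0 := by
  have h : ∀ t : ℝ, exp (t * I) ^ n * conj (exp (t * I)) ^ m = exp (((n : ℂ) - m) * I * t) := by
    intro t
    rw [← Complex.exp_conj, ← Complex.exp_nat_mul, ← Complex.exp_nat_mul, ← Complex.exp_add]
    congr 1
    simp
    ring
  simp only [h]
  split_ifs with hnm
  · simp [hnm]
  · have hne : ((n : ℂ) - m) * I ≠ 0 :=
      mul_ne_zero (sub_ne_zero.2 (by exact_mod_cast hnm)) I_ne_zero
    rw [integral_exp_mul_complex hne]
    have h2 : exp (((n : ℂ) - m) * I * ((2 * Real.pi : ℝ) : ℂ)) = 1 := by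
      rw [Complex.exp_eq_one_iff]
      exact ⟨(n : ℤ) - m, by push_cast; ring⟩
    rw [h2]
    simp

theorem hasSum_integral_mul {f : ℕ → ℝ → ℂ} {b : ℕ → ℝ} {F g : ℝ → ℂ} {B : ℝ}
    (hf : ∀ n, Continuous (f n)) (hfb : ∀ n t, ‖f n t‖ ≤ b n) (hb : Summable b)
    (hF : ∀ t, HasSum (fun n => f n t) (F t)) (hg : Continuous g) (hgB : ∀ t, ‖g t‖ ≤ B) :
    HasSum (fun n => ∫ t in (0 : ℝ)..(2 * Real.pi), f n t * g t)
      (∫ t in (0 : ℝ)..(2 * Real.pi), F t * g t) := by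
  refine intervalIntegral.hasSum_integral_of_dominated_convergence (fun n _ => b n * B)
    (fun n => ((hf n).mul hg).aestronglyMeasurable) (fun n => .of_forall fun t _ => ?_)
    (.of_forall fun _ _ => hb.mul_right B) intervalIntegrable_const
    (.of_forall fun t _ => (hF t).mul_right _)
  rw [norm_mul]
  exact mul_le_mul (hfb n t) (hgB t) (norm_nonneg _) ((norm_nonneg _).trans (hfb n t))

theorem norm_mul_exp_lt {r : ℝ} (hr0 : 0 ≤ r) (hr : r < 1) (t : ℝ) :
    ‖(r : ℂ) * exp (t * I)‖ < 1 := by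
  rwa [norm_mul, norm_exp_ofReal_mul_I, norm_real, Real.norm_of_nonneg hr0, mul_one]

theorem norm_exp_pow (t : ℝ) (n : ℕ) : ‖exp (t * I) ^ n‖ = 1 := by
  rw [norm_pow, norm_exp_ofReal_mul_I, one_pow]

theorem norm_conj_exp_pow (t : ℝ) (n : ℕ) : ‖conj (exp (t * I)) ^ n‖ = 1 := by
  rw [norm_pow, RCLike.norm_conj, norm_exp_ofReal_mul_I, one_pow]

theorem integral_mul_conj_exp_pow {c : ℕ → ℂ} (hc : Summable fun n => ‖c n‖) {F : ℝ → ℂ}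
    (hF : ∀ t : ℝ, HasSum (fun n => c n * exp (t * I) ^ n) (F t)) (m : ℕ) :
    ∫ t in (0 : ℝ)..(2 * Real.pi), F t * conj (exp (t * I)) ^ m = 2 * Real.pi * c m := by
  have h := hasSum_integral_mul (f := fun n t => c n * exp (t * I) ^ n)
    (g := fun t => conj (exp (t * I)) ^ m) (B := 1)
    (fun n => by fun_prop) (fun n t => by rw [norm_mul, norm_exp_pow, mul_one]) hc hF
    (by fun_prop) (fun t => (norm_conj_exp_pow t m).le)
  simp only [mul_assoc, intervalIntegral.integral_const_mul, integral_exp_pow_mul_conj_pow] at h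
  refine h.unique ?_
  have := hasSum_single (f := fun n => c n * if n = m then (2 * Real.pi : ℂ) else 0) m
    fun n hn => by simp [hn]
  simpa [mul_comm] using this

/-- A shifted Parseval identity. Only the conjugated factor is expanded; integrating its n-th term
against F times the k-th negative frequency picks out the coefficient of F with index n + k. -/
theorem hasSum_conj_mul_shift {c : ℕ → ℂ} (hc : Summable fun n => ‖c n‖) {F : ℝ → ℂ}
    (hFc : Continuous F) (hF : ∀ t : ℝ, HasSum (fun n => c n * exp (t * I) ^ n) (F t)) (k : ℕ) :
    HasSum (fun n => conj (c n) * c (n + k)) ((2 * Real.pi : ℂ)⁻¹ *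
      ∫ t in (0 : ℝ)..(2 * Real.pi), conj (F t) * (F t * conj (exp (t * I)) ^ k)) := by
  have hFb : ∀ t, ‖F t‖ ≤ ∑' n, ‖c n‖ := fun t => by
    rw [← (hF t).tsum_eq]
    exact tsum_of_norm_bounded hc.hasSum fun n => by rw [norm_mul, norm_exp_pow, mul_one]
  have h := hasSum_integral_mul (f := fun n t => conj (c n * exp (t * I) ^ n))
    (F := fun t => conj (F t)) (g := fun t => F t * conj (exp (t * I)) ^ k)
    (fun n => by fun_prop)
    (fun n t => by rw [RCLike.norm_conj, norm_mul, norm_exp_pow, mul_one]) hc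
    (fun t => hasSum_conj'.2 (by simpa using hF t))
    (by fun_prop) (fun t => by rw [norm_mul, norm_conj_exp_pow, mul_one]; exact hFb t)
  replace h := h.mul_left (2 * Real.pi : ℂ)⁻¹
  refine h.congr_fun fun n => ?_
  have e : ∀ t : ℝ, conj (c n * exp (t * I) ^ n) * (F t * conj (exp (t * I)) ^ k) =
      conj (c n) * (F t * conj (exp (t * I)) ^ (n + k)) := fun t => by
    rw [map_mul, map_pow, pow_add]
    ring
  have hpi : (2 * Real.pi : ℂ) ≠ 0 := by
    exact_mod_cast Real.two_pi_pos.ne'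
  simp only [e, intervalIntegral.integral_const_mul, integral_mul_conj_exp_pow hc hF]
  field_simp

/-! ### Taylor coefficients of inner functions -/

/-- The Taylor coefficients at the origin. -/
noncomputable def taylorCoeff (θ : ℂ → ℂ) (n : ℕ) : ℂ := (n.factorial : ℂ)⁻¹ * iteratedDeriv n θ 0

namespace IsInner

theorem hasSum_taylorCoeff {θ : ℂ → ℂ} (h : IsInner θ) {z : ℂ} (hz : ‖z‖ < 1) :
    HasSum (fun n => taylorCoeff θ n * z ^ n) (θ z) := by
  have := Complex.hasSum_taylorSeries_on_ball h.differentiableOn (mem_ball_zero_iff.2 hz)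
  refine this.congr_fun fun n => ?_
  simp only [taylorCoeff, sub_zero, smul_eq_mul]
  ring

theorem summable_norm_taylorCoeff {θ : ℂ → ℂ} (h : IsInner θ) {r : ℝ} (hr0 : 0 ≤ r) (hr : r < 1) :
    Summable fun n => ‖taylorCoeff θ n * (r : ℂ) ^ n‖ :=
  (h.hasSum_taylorCoeff (z := r) (by simpa [abs_of_nonneg hr0] using hr)).summable.norm

theorem continuous_circle {θ : ℂ → ℂ} (h : IsInner θ) {r : ℝ} (hr0 : 0 ≤ r) (hr : r < 1) :
    Continuous fun t : ℝ => θ (r * exp (t * I)) :=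
  h.differentiableOn.continuousOn.comp_continuous (by fun_prop)
    fun t => mem_ball_zero_iff.2 (norm_mul_exp_lt hr0 hr t)

theorem hasSum_radius {θ : ℂ → ℂ} (h : IsInner θ) {r : ℝ} (hr0 : 0 ≤ r) (hr : r < 1) (k : ℕ) :
    HasSum (fun n => conj (taylorCoeff θ n) * taylorCoeff θ (n + k) * (r : ℂ) ^ (n + (n + k)))
      ((2 * Real.pi : ℂ)⁻¹ * ∫ t in (0 : ℝ)..(2 * Real.pi), conj (θ (r * exp (t * I))) *
        (θ (r * exp (t * I)) * conj (exp (t * I)) ^ k)) := by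
  refine (hasSum_conj_mul_shift (h.summable_norm_taylorCoeff hr0 hr) (h.continuous_circle hr0 hr)
    (fun t => ?_) k).congr_fun fun n => ?_
  · refine (h.hasSum_taylorCoeff (norm_mul_exp_lt hr0 hr t)).congr_fun fun n => ?_
    rw [mul_pow, mul_assoc]
  · rw [map_mul, map_pow, conj_ofReal, pow_add]
    ring

/-- On each circle of radius r < 1 the mean of |θ|² is at most one. Finite sums survive the limit r
→ 1. -/
theorem sum_sq_taylorCoeff_le {θ : ℂ → ℂ} (h : IsInner θ) (s : Finset ℕ) :
    ∑ n ∈ s, ‖taylorCoeff θ n‖ ^ 2 ≤ 1 := by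
  have h1 : Tendsto (fun r : ℝ => ∑ n ∈ s, ‖taylorCoeff θ n‖ ^ 2 * r ^ (n + n)) (𝓝[<] 1)
      (𝓝 (∑ n ∈ s, ‖taylorCoeff θ n‖ ^ 2 * 1 ^ (n + n))) :=
    (Continuous.tendsto (by fun_prop) 1).mono_left nhdsWithin_le_nhds
  simp only [one_pow, mul_one] at h1
  refine le_of_tendsto h1 ?_
  filter_upwards [Ioo_mem_nhdsLT (zero_lt_one' ℝ)] with r hr
  have hs := h.hasSum_radius hr.1.le hr.2 0
  have e : ∀ n, conj (taylorCoeff θ n) * taylorCoeff θ (n + 0) * (r : ℂ) ^ (n + (n + 0)) =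
      ((‖taylorCoeff θ n‖ ^ 2 * r ^ (n + n) : ℝ) : ℂ) := fun n => by
    rw [add_zero, conj_mul']
    push_cast
    rfl
  have hs' := (Complex.hasSum_re hs).congr_fun fun n => (congrArg re (e n)).symm
  simp only [ofReal_re] at hs'
  have hr0 := hr.1
  refine (sum_le_hasSum s (fun n _ => by positivity) hs').trans ?_
  refine (re_le_norm _).trans ?_
  rw [norm_mul]
  have hI : ‖∫ t in (0 : ℝ)..(2 * Real.pi), conj (θ (r * exp (t * I))) *
        (θ (r * exp (t * I)) * conj (exp (t * I)) ^ 0)‖ ≤ 1 * |2 * Real.pi - 0| := by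
    refine intervalIntegral.norm_integral_le_of_norm_le_const fun t _ => ?_
    have := h.norm_le_one _ (mem_ball_zero_iff.2 (norm_mul_exp_lt hr.1.le hr.2 t))
    rw [pow_zero, mul_one, norm_mul, RCLike.norm_conj]
    exact mul_le_one₀ this (norm_nonneg _) this
  rw [sub_zero, abs_of_pos Real.two_pi_pos, one_mul] at hI
  refine (mul_le_mul_of_nonneg_left hI (norm_nonneg _)).trans (le_of_eq ?_)
  have : ‖(2 * Real.pi : ℂ)⁻¹‖ = (2 * Real.pi)⁻¹ := by
    rw [norm_inv, norm_mul, norm_real, Real.norm_of_nonneg Real.pi_pos.le]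
    simp
  rw [this, inv_mul_cancel₀ Real.two_pi_pos.ne']

theorem norm_taylorCoeff_le {θ : ℂ → ℂ} (h : IsInner θ) (n : ℕ) : ‖taylorCoeff θ n‖ ≤ 1 := by
  have := h.sum_sq_taylorCoeff_le {n}
  rw [Finset.sum_singleton] at this
  exact (sq_le_one_iff₀ (norm_nonneg _)).1 this

theorem summable_sq_taylorCoeff {θ : ℂ → ℂ} (h : IsInner θ) :
    Summable fun n => ‖taylorCoeff θ n‖ ^ 2 :=
  summable_of_sum_le (fun _ => by positivity) h.sum_sq_taylorCoeff_le

theorem summable_norm_conj_mul {θ : ℂ → ℂ} (h : IsInner θ) (k : ℕ) :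
    Summable fun n => ‖conj (taylorCoeff θ n) * taylorCoeff θ (n + k)‖ := by
  have h1 := h.summable_sq_taylorCoeff
  refine Summable.of_nonneg_of_le (fun _ => norm_nonneg _) (fun n => ?_)
    (h1.add ((summable_nat_add_iff k).2 h1))
  rw [norm_mul, RCLike.norm_conj]
  nlinarith [sq_nonneg (‖taylorCoeff θ n‖ - ‖taylorCoeff θ (n + k)‖),
    sq_nonneg ‖taylorCoeff θ n‖, sq_nonneg ‖taylorCoeff θ (n + k)‖]

/-- The functions `θ z ^ k` are orthonormal in the Hardy space of the disc. -/
theorem hasSum_conj_taylorCoeff {θ : ℂ → ℂ} (h : IsInner θ) (k : ℕ) :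
    HasSum (fun n => conj (taylorCoeff θ n) * taylorCoeff θ (n + k)) (if k = 0 then 1 else 0) := by
  have hsum := h.summable_norm_conj_mul k
  have hIoo := Ioo_mem_nhdsLT (zero_lt_one' ℝ)
  -- Both sides of the Parseval identity on radius r converge as r → 1: the series is dominated by
  -- its values at r = 1, the integral by the constant one.
  have h1 : Tendsto (fun r : ℝ => ∑' n, conj (taylorCoeff θ n) * taylorCoeff θ (n + k) *
      (r : ℂ) ^ (n + (n + k))) (𝓝[<] 1)
      (𝓝 (∑' n, conj (taylorCoeff θ n) * taylorCoeff θ (n + k))) := by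
    refine tendsto_tsum_of_dominated_convergence hsum (fun n => ?_) ?_
    · have : Tendsto (fun r : ℝ => conj (taylorCoeff θ n) * taylorCoeff θ (n + k) *
          (r : ℂ) ^ (n + (n + k))) (𝓝 1) (𝓝 (conj (taylorCoeff θ n) * taylorCoeff θ (n + k) *
          ((1 : ℝ) : ℂ) ^ (n + (n + k)))) := Continuous.tendsto (by fun_prop) 1
      simp only [ofReal_one, one_pow, mul_one] at this
      exact this.mono_left nhdsWithin_le_nhds
    · filter_upwards [hIoo] with r hr n
      rw [norm_mul _ ((r : ℂ) ^ _), norm_pow, norm_real, Real.norm_of_nonneg hr.1.le]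
      exact mul_le_of_le_one_right (norm_nonneg _) (pow_le_one₀ hr.1.le hr.2.le)
  have h2 : Tendsto (fun r : ℝ => ∫ t in (0 : ℝ)..(2 * Real.pi), conj (θ (r * exp (t * I))) *
        (θ (r * exp (t * I)) * conj (exp (t * I)) ^ k)) (𝓝[<] 1)
      (𝓝 (∫ t in (0 : ℝ)..(2 * Real.pi), exp (t * I) ^ 0 * conj (exp (t * I)) ^ k)) := by
    refine intervalIntegral.tendsto_integral_filter_of_dominated_convergence (fun _ => 1) ?_ ?_
      intervalIntegrable_const ?_
    · filter_upwards [hIoo] with r hr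
      have := h.continuous_circle hr.1.le hr.2
      exact Continuous.aestronglyMeasurable
        ((continuous_conj.comp this).mul (this.mul (by fun_prop)))
    · filter_upwards [hIoo] with r hr
      refine .of_forall fun t _ => ?_
      have := h.norm_le_one _ (mem_ball_zero_iff.2 (norm_mul_exp_lt hr.1.le hr.2 t))
      rw [norm_mul, RCLike.norm_conj, norm_mul, norm_conj_exp_pow, mul_one]
      exact mul_le_one₀ this (norm_nonneg _) this
    -- The only use of the radial limits here: conj(ζ) ζ = 1, so θ disappears from the limiting
    -- integrand.
    · filter_upwards [h.radial_limit] with t ht _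
      obtain ⟨ζ, hζ, hlim⟩ := ht
      have := ((continuous_conj.tendsto ζ).comp hlim).mul
        (hlim.mul_const (conj (exp (t * I)) ^ k))
      rw [← mul_assoc, conj_mul', hζ] at this
      simpa using this
  rw [integral_exp_pow_mul_conj_pow] at h2
  have h3 := (h2.const_mul (2 * Real.pi : ℂ)⁻¹).congr' (show _ =ᶠ[𝓝[<] (1 : ℝ)] _ by
    filter_upwards [hIoo] with r hr using (h.hasSum_radius hr.1.le hr.2 k).tsum_eq.symm)
  have h4 := tendsto_nhds_unique h1 h3
  have h5 := hsum.of_norm.hasSum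
  rw [h4] at h5
  convert! h5 using 1
  have hpi : (2 * Real.pi : ℂ) ≠ 0 := by exact_mod_cast Real.two_pi_pos.ne'
  by_cases hk : k = 0
  · rw [if_pos hk, if_pos hk.symm, inv_mul_cancel₀ hpi]
  · simp [hk, Ne.symm hk]

end IsInner

/-! ### The monomial basis -/

theorem mulOp_apply (φ : ℂ × ℂ → ℂ) (hφ : DifferentiableOn ℂ φ hartogsTriangle)
    (hb : ∀ p ∈ hartogsTriangle, ‖φ p‖ ≤ 1) (f : HardySpace) (p : ℂ × ℂ) :
    mulOp φ hφ hb f p = φ p * f p := rfl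

namespace HardySpace

/-- The coefficient map as an isometry onto `ℓ²`. -/
noncomputable def coeffIsometry : HardySpace ≃ₗᵢ[ℂ] lp (fun _ : ℕ × ℕ => ℂ) 2 :=
  ⟨LinearEquiv.ofBijective coeffMap coeffMap_bijective, norm_coeffMap⟩

/-- The orthonormal basis of the functions `w⁻¹ (z / w) ^ i w ^ j`. -/
noncomputable def monomial : HilbertBasis (ℕ × ℕ) ℂ HardySpace := .ofRepr coeffIsometry

theorem inner_monomial (p : ℕ × ℕ) (f : HardySpace) :
    inner ℂ (monomial p) f = hardyCoeff f p :=
  (monomial.repr_apply_apply f p).symm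

theorem inner_monomial_monomial (p q : ℕ × ℕ) :
    inner ℂ (monomial p) (monomial q) = if p = q then 1 else 0 :=
  orthonormal_iff_ite.1 monomial.orthonormal p q

theorem ext_inner_monomial {f g : HardySpace}
    (h : ∀ p, inner ℂ (monomial p) f = inner ℂ (monomial p) g) : f = g :=
  coeffMap_bijective.1 <| lp.ext <| funext fun p => by
    rw [coeffMap_apply, coeffMap_apply, ← inner_monomial, ← inner_monomial, h]

/-- Pointwise expansions determine the Hilbert space coefficients. The factor `q.2` clears the w⁻¹
carried by every basis function. -/
theorem inner_monomial_eq_of_hasSum {f : HardySpace} {A : ℕ × ℕ → ℂ} {B : ℝ} (hA : ∀ p, ‖A p‖ ≤ B)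
    (h : ∀ q ∈ hartogsTriangle,
      HasSum (fun p : ℕ × ℕ => A p * ((q.1 / q.2) ^ p.1 * q.2 ^ p.2)) (q.2 * f q)) (p : ℕ × ℕ) :
    inner ℂ (monomial p) f = A p := by
  have e : f.toFun = hartogsSeries A := by
    ext q
    by_cases hq : q ∈ hartogsTriangle
    · rw [hartogsSeries, if_pos hq, bidiscSeries, (h q hq).tsum_eq,
        inv_mul_cancel_left₀ (snd_ne_zero hq)]
    · rw [hartogsSeries, if_neg hq, f.mem.2.2 q hq]
  rw [inner_monomial, e, hardyCoeff_hartogsSeries hA]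

/-- The basis is obtained abstractly from the coefficient isometry; its members are identified as
functions by comparing coefficients with the series that has a single nonzero term. -/
theorem monomial_apply (p : ℕ × ℕ) {q : ℂ × ℂ} (hq : q ∈ hartogsTriangle) :
    monomial p q = q.2⁻¹ * ((q.1 / q.2) ^ p.1 * q.2 ^ p.2) := by
  have hb : ∀ r, ‖(Pi.single p 1 : ℕ × ℕ → ℂ) r‖ ≤ 1 := fun r => by
    by_cases hr : r = p
    · subst hr; simp
    · simp [hr]
  have hs : Summable fun r => ‖(Pi.single p 1 : ℕ × ℕ → ℂ) r‖ ^ 2 :=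
    summable_of_ne_finset_zero (s := {p}) fun r hr => by
      simp [Finset.notMem_singleton.1 hr]
  have e : monomial p = ofMem _ (hartogsSeries_mem hs) := ext_inner_monomial fun r => by
    rw [inner_monomial_monomial, inner_monomial]
    refine Eq.trans ?_ (hardyCoeff_hartogsSeries hb r).symm
    rw [Pi.single_apply]
  rw [e]
  change hartogsSeries _ q = _
  rw [hartogsSeries, if_pos hq, bidiscSeries, tsum_eq_single p fun r hr => by simp [hr]]
  simp

/-- Upgrades pointwise convergence to convergence in norm. Bounded coefficients suffice because,
extended by zero off the range of `g`, they are the basis coefficients of an `f` already known to be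
in the space. -/
theorem hasSum_monomial {f : HardySpace} {g : ℕ → ℕ × ℕ} (hg : Function.Injective g)
    {a : ℕ → ℂ} {B : ℝ} (ha : ∀ n, ‖a n‖ ≤ B) (h : ∀ q ∈ hartogsTriangle,
      HasSum (fun n => a n * ((q.1 / q.2) ^ (g n).1 * q.2 ^ (g n).2)) (q.2 * f q)) :
    HasSum (fun n => a n • monomial (g n)) f := by
  have hz : ∀ p ∉ range g, Function.extend g a 0 p = 0 := fun p hp =>
    Function.extend_apply' _ _ _ fun ⟨n, hn⟩ => hp ⟨n, hn⟩
  have hc := inner_monomial_eq_of_hasSum (f := f) (A := Function.extend g a 0) (B := B)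
    (fun p => by
      by_cases hp : p ∈ range g
      · obtain ⟨n, rfl⟩ := hp
        rw [hg.extend_apply]
        exact ha n
      · rw [hz p hp, norm_zero]
        exact (norm_nonneg _).trans (ha 0))
    (fun q hq => by
      rw [← hg.hasSum_iff fun p hp => by rw [hz p hp, zero_mul]]
      simpa [Function.comp_def, hg.extend_apply] using h q hq)
  have h1 := monomial.hasSum_repr f
  simp only [monomial.repr_apply_apply, hc] at h1
  rw [← hg.hasSum_iff fun p hp => by rw [hz p hp, zero_smul]] at h1
  simpa [Function.comp_def, hg.extend_apply] using h1

end HardySpace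

/-! ### The two shifts and their adjoints -/

open HardySpace ContinuousLinearMap

theorem norm_div_le_one {p : ℂ × ℂ} (hp : p ∈ hartogsTriangle) : ‖p.1 / p.2‖ ≤ 1 :=
  (norm_div_lt_one hp).le

theorem differentiableOn_div : DifferentiableOn ℂ (fun p : ℂ × ℂ => p.1 / p.2) hartogsTriangle :=
  fun p hp => by
    have := snd_ne_zero hp
    simp only [div_eq_mul_inv]
    exact (differentiableAt_fst.mul (differentiableAt_snd.inv this)).differentiableWithinAt

/-- Multiplication by `z / w`. -/
noncomputable def divOp : HardySpace →L[ℂ] HardySpace :=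
  mulOp (fun p => p.1 / p.2) differentiableOn_div fun _ hp => norm_div_le_one hp

/-- Multiplication by `θ (z / w)`. -/
noncomputable def innerDivOp {θ : ℂ → ℂ} (h : IsInner θ) : HardySpace →L[ℂ] HardySpace :=
  mulOp (fun p => θ (p.1 / p.2))
    (h.differentiableOn.comp differentiableOn_div fun _ hp =>
      mem_ball_zero_iff.2 (norm_div_lt_one hp))
    fun _ hp => h.norm_le_one _ (mem_ball_zero_iff.2 (norm_div_lt_one hp))

/-- Multiplication by `θ w`. -/
noncomputable def innerSndOp {θ : ℂ → ℂ} (h : IsInner θ) : HardySpace →L[ℂ] HardySpace :=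
  mulOp (fun p => θ p.2)
    (h.differentiableOn.comp differentiableOn_snd fun _ hp => mem_ball_zero_iff.2 hp.2)
    fun _ hp => h.norm_le_one _ (mem_ball_zero_iff.2 hp.2)

theorem mulOp_comm (φ ψ : ℂ × ℂ → ℂ) (hφ : DifferentiableOn ℂ φ hartogsTriangle)
    (hb : ∀ p ∈ hartogsTriangle, ‖φ p‖ ≤ 1) (hψ : DifferentiableOn ℂ ψ hartogsTriangle)
    (hb' : ∀ p ∈ hartogsTriangle, ‖ψ p‖ ≤ 1) (f : HardySpace) :
    mulOp φ hφ hb (mulOp ψ hψ hb' f) = mulOp ψ hψ hb' (mulOp φ hφ hb f) :=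
  HardySpace.ext fun p _ => by simp only [mulOp_apply, mul_left_comm]

theorem adjoint_comm {S T : HardySpace →L[ℂ] HardySpace} (h : ∀ f, S (T f) = T (S f))
    (f : HardySpace) : adjoint S (adjoint T f) = adjoint T (adjoint S f) :=
  ext_inner_left ℂ fun g => by simp only [adjoint_inner_right, h]

/-- This factorization transfers the problem to the two independent shifts of the bidisc. -/
theorem Mz_apply_eq (f : HardySpace) : Mz f = divOp (Mw f) :=
  HardySpace.ext fun p hp => by
    have := snd_ne_zero hp
    simp only [Mz, Mw, divOp, mulOp_apply]
    field_simp

theorem adjoint_Mz_apply (f : HardySpace) : adjoint Mz f = adjoint Mw (adjoint divOp f) :=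
  ext_inner_left ℂ fun g => by simp only [adjoint_inner_right, Mz_apply_eq]

theorem divOp_monomial (i j : ℕ) : divOp (monomial (i, j)) = monomial (i + 1, j) :=
  HardySpace.ext fun p hp => by
    rw [monomial_apply _ hp, divOp, mulOp_apply, monomial_apply _ hp]
    ring

theorem Mw_monomial (i j : ℕ) : Mw (monomial (i, j)) = monomial (i, j + 1) :=
  HardySpace.ext fun p hp => by
    rw [monomial_apply _ hp, Mw, mulOp_apply, monomial_apply _ hp]
    ring

theorem inner_monomial_adjoint_divOp (i j : ℕ) (f : HardySpace) :
    inner ℂ (monomial (i, j)) (adjoint divOp f) = inner ℂ (monomial (i + 1, j)) f := by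
  rw [adjoint_inner_right, divOp_monomial]

theorem inner_monomial_adjoint_Mw (i j : ℕ) (f : HardySpace) :
    inner ℂ (monomial (i, j)) (adjoint Mw f) = inner ℂ (monomial (i, j + 1)) f := by
  rw [adjoint_inner_right, Mw_monomial]

theorem adjoint_divOp_monomial_zero (j : ℕ) : adjoint divOp (monomial (0, j)) = 0 :=
  ext_inner_monomial fun ⟨k, l⟩ => by
    simp [inner_monomial_adjoint_divOp, inner_monomial_monomial]

theorem adjoint_Mw_monomial_zero (i : ℕ) : adjoint Mw (monomial (i, 0)) = 0 :=
  ext_inner_monomial fun ⟨k, l⟩ => by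
    simp [inner_monomial_adjoint_Mw, inner_monomial_monomial]

theorem inner_monomial_zero_divOp (j : ℕ) (f : HardySpace) :
    inner ℂ (monomial (0, j)) (divOp f) = 0 := by
  rw [← adjoint_inner_left, adjoint_divOp_monomial_zero, inner_zero_left]

theorem inner_monomial_zero_Mw (i : ℕ) (f : HardySpace) :
    inner ℂ (monomial (i, 0)) (Mw f) = 0 := by
  rw [← adjoint_inner_left, adjoint_Mw_monomial_zero, inner_zero_left]

theorem adjoint_divOp_monomial_succ (i j : ℕ) :
    adjoint divOp (monomial (i + 1, j)) = monomial (i, j) :=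
  ext_inner_monomial fun ⟨k, l⟩ => by
    simp [inner_monomial_adjoint_divOp, inner_monomial_monomial]

theorem adjoint_Mw_monomial_succ (i j : ℕ) :
    adjoint Mw (monomial (i, j + 1)) = monomial (i, j) :=
  ext_inner_monomial fun ⟨k, l⟩ => by
    simp [inner_monomial_adjoint_Mw, inner_monomial_monomial]

theorem inner_monomial_succ_divOp (i j : ℕ) (f : HardySpace) :
    inner ℂ (monomial (i + 1, j)) (divOp f) = inner ℂ (monomial (i, j)) f := by
  rw [← adjoint_inner_left, adjoint_divOp_monomial_succ]

theorem inner_monomial_succ_Mw (i j : ℕ) (f : HardySpace) :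
    inner ℂ (monomial (i, j + 1)) (Mw f) = inner ℂ (monomial (i, j)) f := by
  rw [← adjoint_inner_left, adjoint_Mw_monomial_succ]

theorem adjoint_divOp_divOp (f : HardySpace) : adjoint divOp (divOp f) = f :=
  ext_inner_monomial fun ⟨i, j⟩ => by
    rw [inner_monomial_adjoint_divOp, inner_monomial_succ_divOp]

theorem adjoint_Mw_Mw (f : HardySpace) : adjoint Mw (Mw f) = f :=
  ext_inner_monomial fun ⟨i, j⟩ => by
    rw [inner_monomial_adjoint_Mw, inner_monomial_succ_Mw]

/-- The shifts act on different indices, hence doubly commute on the whole space. -/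
theorem adjoint_divOp_Mw (f : HardySpace) : adjoint divOp (Mw f) = Mw (adjoint divOp f) :=
  ext_inner_monomial fun ⟨i, j⟩ => by
    rw [inner_monomial_adjoint_divOp]
    cases j with
    | zero => rw [inner_monomial_zero_Mw, inner_monomial_zero_Mw]
    | succ j => rw [inner_monomial_succ_Mw, inner_monomial_succ_Mw, inner_monomial_adjoint_divOp]

theorem adjoint_Mw_divOp (f : HardySpace) : adjoint Mw (divOp f) = divOp (adjoint Mw f) :=
  ext_inner_monomial fun ⟨i, j⟩ => by
    rw [inner_monomial_adjoint_Mw]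
    cases i with
    | zero => rw [inner_monomial_zero_divOp, inner_monomial_zero_divOp]
    | succ i => rw [inner_monomial_succ_divOp, inner_monomial_succ_divOp, inner_monomial_adjoint_Mw]

/-- `Mw` composed with its adjoint removes the components with second index 0; by hypothesis only
the one at (0, 0) can be present. -/
theorem Mw_adjoint_Mw {f : HardySpace} {c : ℂ}
    (h : ∀ i, inner ℂ (monomial (i, 0)) f = if i = 0 then c else 0) :
    Mw (adjoint Mw f) = f - c • monomial (0, 0) :=
  ext_inner_monomial fun ⟨i, j⟩ => by
    rw [inner_sub_right, inner_smul_right, inner_monomial_monomial]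
    cases j with
    | zero => simp [inner_monomial_zero_Mw, h]
    | succ j => simp [inner_monomial_succ_Mw, inner_monomial_adjoint_Mw]

/-! ### Multiplication by inner functions as Toeplitz operators -/

/-- The indices are written in swapped order so that this operator, like `innerSndOp`, raises the
second index of a doubly indexed family; one abstract lemma then serves both variables. -/
theorem hasSum_innerDivOp {θ : ℂ → ℂ} (h : IsInner θ) (i j : ℕ) :
    HasSum (fun n => taylorCoeff θ n • monomial (j + n, i)) (innerDivOp h (monomial (j, i))) := by
  refine hasSum_monomial (g := fun n => (j + n, i)) (fun m n hmn => by simpa using hmn)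
    h.norm_taylorCoeff_le fun q hq => ?_
  rw [innerDivOp, mulOp_apply, monomial_apply _ hq, mul_left_comm,
    mul_inv_cancel_left₀ (snd_ne_zero hq)]
  refine ((h.hasSum_taylorCoeff (norm_div_lt_one hq)).mul_right _).congr_fun fun n => ?_
  simp only [pow_add]
  ring

theorem hasSum_innerSndOp {θ : ℂ → ℂ} (h : IsInner θ) (i j : ℕ) :
    HasSum (fun n => taylorCoeff θ n • monomial (i, j + n)) (innerSndOp h (monomial (i, j))) := by
  refine hasSum_monomial (g := fun n => (i, j + n)) (fun m n hmn => by simpa using hmn)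
    h.norm_taylorCoeff_le fun q hq => ?_
  rw [innerSndOp, mulOp_apply, monomial_apply _ hq, mul_left_comm,
    mul_inv_cancel_left₀ (snd_ne_zero hq)]
  refine ((h.hasSum_taylorCoeff hq.2).mul_right _).congr_fun fun n => ?_
  simp only [pow_add]
  ring

section Toeplitz

variable {H : Type*} [NormedAddCommGroup H] [InnerProductSpace ℂ H]
  {b : ℕ → ℕ → H} {A : H →L[ℂ] H} {a : ℕ → ℂ}

theorem inner_toeplitz
    (hb : ∀ i j k l, inner ℂ (b i j) (b k l) = if i = k ∧ j = l then (1 : ℂ) else 0)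
    (hA : ∀ i j, HasSum (fun n => a n • b i (j + n)) (A (b i j))) (i k n : ℕ) :
    inner ℂ (b i n) (A (b k 0)) = if i = k then a n else 0 := by
  have h1 := (innerSL ℂ (b i n)).hasSum (hA k 0)
  simp only [map_smul, innerSL_apply_apply, hb, smul_eq_mul, zero_add] at h1
  refine h1.unique ?_
  have h2 := hasSum_single (f := fun m => a m * if i = k ∧ n = m then (1 : ℂ) else 0) n
    fun m hm => by simp [hm.symm]
  convert! h2 using 1
  simp

/-- `A` never lowers the second index, so `b k 0` meets `A (b i j)` only in the diagonal term i = k,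
j = 0. -/
theorem adjoint_toeplitz [CompleteSpace H]
    (hb : ∀ i j k l, inner ℂ (b i j) (b k l) = if i = k ∧ j = l then (1 : ℂ) else 0)
    (hext : ∀ f g : H, (∀ i j, inner ℂ (b i j) f = inner ℂ (b i j) g) → f = g)
    (hA : ∀ i j, HasSum (fun n => a n • b i (j + n)) (A (b i j))) (k : ℕ) :
    adjoint A (b k 0) = conj (a 0) • b k 0 := by
  refine hext _ _ fun i j => ?_
  rw [adjoint_inner_right, inner_smul_right, hb, ← inner_conj_symm]
  have h1 := (innerSL ℂ (b k 0)).hasSum (hA i j)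
  simp only [map_smul, innerSL_apply_apply, hb, smul_eq_mul] at h1
  have h2 := hasSum_single (f := fun n => a n * if k = i ∧ 0 = j + n then (1 : ℂ) else 0) 0
    fun n hn => by rw [if_neg (by omega), mul_zero]
  rw [h1.unique h2]
  simp [eq_comm, apply_ite conj]

/-- The coefficient at `b i j` is an inner product of two images under `A`; it vanishes for i ≠ k
and otherwise is the sum in `ha` with shift j. Starting at second index 0 means that only
nonnegative shifts occur. -/
theorem adjoint_toeplitz_toeplitz [CompleteSpace H]
    (hb : ∀ i j k l, inner ℂ (b i j) (b k l) = if i = k ∧ j = l then (1 : ℂ) else 0)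
    (hext : ∀ f g : H, (∀ i j, inner ℂ (b i j) f = inner ℂ (b i j) g) → f = g)
    (hA : ∀ i j, HasSum (fun n => a n • b i (j + n)) (A (b i j)))
    (ha : ∀ k, HasSum (fun n => conj (a n) * a (n + k)) (if k = 0 then 1 else 0)) (k : ℕ) :
    adjoint A (A (b k 0)) = b k 0 := by
  refine hext _ _ fun i j => ?_
  rw [adjoint_inner_right, hb, ← inner_conj_symm]
  have h1 := (innerSL ℂ (A (b k 0))).hasSum (hA i j)
  simp only [map_smul, innerSL_apply_apply, smul_eq_mul] at h1
  have h2 := hasSum_conj'.2 h1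
  simp only [map_mul, inner_conj_symm, inner_toeplitz hb hA] at h2
  by_cases hik : i = k
  · simp only [hik, if_true, add_comm j] at h2
    rw [hik]
    simpa using h2.unique (ha j)
  · simp only [if_neg hik, mul_zero] at h2
    simpa [hik] using h2.unique hasSum_zero

end Toeplitz

theorem inner_monomial_swap (i j k l : ℕ) :
    inner ℂ (monomial (j, i)) (monomial (l, k)) = if i = k ∧ j = l then (1 : ℂ) else 0 := by
  simp [inner_monomial_monomial, and_comm]

theorem inner_monomial_pair (i j k l : ℕ) :
    inner ℂ (monomial (i, j)) (monomial (k, l)) = if i = k ∧ j = l then (1 : ℂ) else 0 := by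
  simp [inner_monomial_monomial]

theorem inner_monomial_innerDivOp {θ : ℂ → ℂ} (h : IsInner θ) (i j k : ℕ) :
    inner ℂ (monomial (i, j)) (innerDivOp h (monomial (0, k))) =
      if j = k then taylorCoeff θ i else 0 :=
  inner_toeplitz (b := fun i j => monomial (j, i)) inner_monomial_swap (hasSum_innerDivOp h) j k i

theorem inner_monomial_innerSndOp {θ : ℂ → ℂ} (h : IsInner θ) (i j k : ℕ) :
    inner ℂ (monomial (i, j)) (innerSndOp h (monomial (k, 0))) =
      if i = k then taylorCoeff θ j else 0 :=
  inner_toeplitz (b := fun i j => monomial (i, j)) inner_monomial_pair (hasSum_innerSndOp h) i k j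

theorem adjoint_innerDivOp_innerDivOp {θ : ℂ → ℂ} (h : IsInner θ) (k : ℕ) :
    adjoint (innerDivOp h) (innerDivOp h (monomial (0, k))) = monomial (0, k) :=
  adjoint_toeplitz_toeplitz (b := fun i j => monomial (j, i)) inner_monomial_swap
    (fun _ _ hfg => ext_inner_monomial fun p => hfg p.2 p.1) (hasSum_innerDivOp h)
    h.hasSum_conj_taylorCoeff k

theorem adjoint_innerSndOp_innerSndOp {θ : ℂ → ℂ} (h : IsInner θ) (k : ℕ) :
    adjoint (innerSndOp h) (innerSndOp h (monomial (k, 0))) = monomial (k, 0) :=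
  adjoint_toeplitz_toeplitz (b := fun i j => monomial (i, j)) inner_monomial_pair
    (fun _ _ hfg => ext_inner_monomial fun p => hfg p.1 p.2) (hasSum_innerSndOp h)
    h.hasSum_conj_taylorCoeff k

theorem adjoint_innerSndOp_monomial {θ : ℂ → ℂ} (h : IsInner θ) (k : ℕ) :
    adjoint (innerSndOp h) (monomial (k, 0)) = conj (taylorCoeff θ 0) • monomial (k, 0) :=
  adjoint_toeplitz (b := fun i j => monomial (i, j)) inner_monomial_pair
    (fun _ _ hfg => ext_inner_monomial fun p => hfg p.1 p.2) (hasSum_innerSndOp h) k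

/-! ### Compressions to the quotient module -/

namespace QuotientModule

variable (Q : QuotientModule)

/-- The adjoint of P T|_Q is P T*|_Q, and the projection is superfluous on a subspace invariant
under T*. -/
theorem coe_adjoint_compression {T : HardySpace →L[ℂ] HardySpace}
    (hT : ∀ f ∈ Q.toSubmodule, adjoint T f ∈ Q.toSubmodule) (f : Q.toSubmodule) :
    (adjoint (Q.compression T) f : HardySpace) = adjoint T f := by
  rw [compression, adjoint_comp, adjoint_comp, Submodule.adjoint_subtypeL,
    Submodule.adjoint_orthogonalProjectionOnto]
  exact congrArg Subtype.val
    (Submodule.orthogonalProjectionOnto_mem_subspace_eq_self (⟨_, hT f f.2⟩ : Q.toSubmodule))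

theorem compression_eq (T : HardySpace →L[ℂ] HardySpace) (f y : Q.toSubmodule)
    (h : T f - y ∈ Q.toSubmoduleᗮ) : Q.compression T f = y := by
  have h1 := Submodule.orthogonalProjectionOnto_apply_of_mem_orthogonal h
  rw [map_sub, Submodule.orthogonalProjectionOnto_mem_subspace_eq_self, sub_eq_zero] at h1
  exact h1

/-- The commutator evaluated at one vector. The projections onto Q are supplied as candidates `y`,
`y'` with orthogonal remainders, so no formula for the projection is required. -/
theorem IsDoublyCommuting.adjoint_Mz_eq {Q : QuotientModule} (hQ : Q.IsDoublyCommuting)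
    {f y y' : HardySpace} (hf : f ∈ Q.toSubmodule) (hy : y ∈ Q.toSubmodule)
    (hy' : y' ∈ Q.toSubmodule) (h : Mw f - y ∈ Q.toSubmoduleᗮ)
    (h' : Mw (adjoint Mz f) - y' ∈ Q.toSubmoduleᗮ) : adjoint Mz y = y' := by
  have h1 := DFunLike.congr_fun (sub_eq_zero.1 hQ) (⟨f, hf⟩ : Q.toSubmodule)
  simp only [comp_apply] at h1
  have e : adjoint (Q.compression Mz) ⟨f, hf⟩ = ⟨adjoint Mz f, Q.adjoint_Mz_mem f hf⟩ :=
    Subtype.ext (Q.coe_adjoint_compression Q.adjoint_Mz_mem ⟨f, hf⟩)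
  have e₁ : Q.compression Mw ⟨f, hf⟩ = ⟨y, hy⟩ := Q.compression_eq Mw ⟨f, hf⟩ ⟨y, hy⟩ h
  have e₂ : Q.compression Mw ⟨adjoint Mz f, Q.adjoint_Mz_mem f hf⟩ = ⟨y', hy'⟩ :=
    Q.compression_eq Mw ⟨adjoint Mz f, Q.adjoint_Mz_mem f hf⟩ ⟨y', hy'⟩ h'
  rw [e, e₁, e₂] at h1
  rw [← Q.coe_adjoint_compression Q.adjoint_Mz_mem ⟨y, hy⟩, h1]

theorem isDoublyCommuting_of_compression_Mz (h : Q.compression Mz = 0) : Q.IsDoublyCommuting := by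
  simp [IsDoublyCommuting, h]

theorem isDoublyCommuting_of_compression_Mw {b : ℂ}
    (h : Q.compression Mw = b • ContinuousLinearMap.id ℂ _) : Q.IsDoublyCommuting := by
  rw [IsDoublyCommuting, h, sub_eq_zero]
  ext f
  simp

end QuotientModule

/-- The inclusion S ⊆ S⊥⊥ is enough, so closedness of θ H² plays no role. -/
theorem mem_orthogonal_of_multiples {θ : ℂ × ℂ → ℂ} {g : HardySpace} (f : HardySpace)
    (h : ∀ p ∈ hartogsTriangle, g p = θ p * f p) : g ∈ (quotientModule θ).toSubmoduleᗮ :=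
  Submodule.le_orthogonal_orthogonal (multiples θ) ⟨f, h⟩

theorem mem_quotientModule {θ₁ θ₂ : ℂ → ℂ} (h₁ : IsInner θ₁) (h₂ : IsInner θ₂) {f : HardySpace}
    (hf : adjoint (innerSndOp h₂) (adjoint (innerDivOp h₁) f) = 0) :
    f ∈ (quotientModule fun p => θ₁ (p.1 / p.2) * θ₂ p.2).toSubmodule := by
  rintro g ⟨k, hk⟩
  have hg : g = innerDivOp h₁ (innerSndOp h₂ k) := HardySpace.ext fun p hp => by
    rw [hk p hp, innerDivOp, innerSndOp, mulOp_apply, mulOp_apply, mul_assoc]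
  rw [hg, ← adjoint_inner_right, ← adjoint_inner_right, hf, inner_zero_right]

theorem adjoint_innerDivOp_innerSndOp_comm {θ₁ θ₂ : ℂ → ℂ} (h₁ : IsInner θ₁) (h₂ : IsInner θ₂)
    (f : HardySpace) : adjoint (innerSndOp h₂) (adjoint (innerDivOp h₁) f) =
      adjoint (innerDivOp h₁) (adjoint (innerSndOp h₂) f) :=
  adjoint_comm (mulOp_comm _ _ _ _ _ _) f

/-! ### Necessity: the first inner function -/

/-- Double commutativity forces the first inner function to be affine. -/
theorem taylorCoeff_fst_eq_zero {θ₁ θ₂ : ℂ → ℂ} (h₁ : IsInner θ₁) (h₂ : IsInner θ₂)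
    (hQ : (quotientModule fun p => θ₁ (p.1 / p.2) * θ₂ p.2).IsDoublyCommuting) (n : ℕ) :
    taylorCoeff θ₁ (n + 2) = 0 := by
  have hc : ∀ f, adjoint (innerDivOp h₁) (adjoint divOp f) =
      adjoint divOp (adjoint (innerDivOp h₁) f) := adjoint_comm (mulOp_comm _ _ _ _ _ _)
  have hMw : ∀ f, innerDivOp h₁ (Mw f) = Mw (innerDivOp h₁ f) := mulOp_comm _ _ _ _ _ _
  have hV : Mw (innerDivOp h₁ (monomial (0, 0))) = innerDivOp h₁ (monomial (0, 1)) := by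
    rw [← hMw, Mw_monomial]
  have hVA : adjoint Mw (innerDivOp h₁ (monomial (0, 0))) = 0 := ext_inner_monomial fun ⟨i, j⟩ => by
    rw [inner_monomial_adjoint_Mw, inner_monomial_innerDivOp]
    simp
  have hUV : ∀ f, adjoint Mw (adjoint divOp f) = adjoint divOp (adjoint Mw f) :=
    adjoint_comm (mulOp_comm _ _ _ _ _ _)
  -- The test vector is the backward shift of θ₁ in z/w. Its product with w stays in Q, so the first
  -- projection is trivial; it does not involve w beyond the factor w⁻¹, so the adjoint of `Mz`
  -- kills it and `y'` is 0.
  have key := hQ.adjoint_Mz_eq (f := adjoint divOp (innerDivOp h₁ (monomial (0, 0))))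
    (y := Mw (adjoint divOp (innerDivOp h₁ (monomial (0, 0))))) (y' := 0)
    (mem_quotientModule h₁ h₂ (by
      rw [hc, adjoint_innerDivOp_innerDivOp, adjoint_divOp_monomial_zero, map_zero]))
    (mem_quotientModule h₁ h₂ (by
      rw [← adjoint_divOp_Mw, hc, hV, adjoint_innerDivOp_innerDivOp, adjoint_divOp_monomial_zero,
        map_zero]))
    (Submodule.zero_mem _) (by rw [sub_self]; exact Submodule.zero_mem _)
    (by
      rw [adjoint_Mz_apply, hUV, hUV, hVA, map_zero, map_zero, map_zero, sub_zero]
      exact Submodule.zero_mem _)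
  rw [adjoint_Mz_apply, hUV, adjoint_Mw_Mw] at key
  have := congrArg (inner ℂ (monomial (n, 0))) key
  rw [inner_monomial_adjoint_divOp, inner_monomial_adjoint_divOp, inner_monomial_innerDivOp] at this
  simpa using this

/-! ### Necessity: the identity for the second inner function -/

theorem mem_quotientModule_of_snd {θ₁ θ₂ : ℂ → ℂ} (h₁ : IsInner θ₁) (h₂ : IsInner θ₂)
    {f : HardySpace} (hf : adjoint (innerSndOp h₂) f = 0) :
    f ∈ (quotientModule fun p => θ₁ (p.1 / p.2) * θ₂ p.2).toSubmodule :=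
  mem_quotientModule h₁ h₂ (by rw [adjoint_innerDivOp_innerSndOp_comm, hf, map_zero])

section SecondVariable

variable {θ : ℂ → ℂ} (h : IsInner θ)

/-- The backward shift of θ lies in the model space of θ: the two adjoints commute, and what remains
is the backward shift of a vector constant in w up to the factor w⁻¹. -/
theorem adjoint_innerSndOp_adjoint_Mw (k : ℕ) :
    adjoint (innerSndOp h) (adjoint Mw (innerSndOp h (monomial (k, 0)))) = 0 := by
  rw [adjoint_comm (S := innerSndOp h) (T := Mw) (mulOp_comm _ _ _ _ _ _),
    adjoint_innerSndOp_innerSndOp, adjoint_Mw_monomial_zero]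

/-- For each k the vector is a copy of 1 - conj(θ(0)) θ, the reproducing kernel at the origin of the
model space of θ; it is the projection of `monomial (k, 0)` to the kernel of the adjoint. -/
theorem adjoint_innerSndOp_sub (k : ℕ) :
    adjoint (innerSndOp h) (monomial (k, 0) -
      conj (taylorCoeff θ 0) • innerSndOp h (monomial (k, 0))) = 0 := by
  rw [map_sub, map_smul, adjoint_innerSndOp_innerSndOp, adjoint_innerSndOp_monomial, sub_self]

theorem divOp_innerSndOp (k : ℕ) :
    divOp (innerSndOp h (monomial (k, 0))) = innerSndOp h (monomial (k + 1, 0)) := by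
  rw [← divOp_monomial]
  exact mulOp_comm _ _ _ _ _ _ _

theorem Mw_adjoint_Mw_innerSndOp :
    Mw (adjoint Mw (innerSndOp h (monomial (0, 0)))) =
      innerSndOp h (monomial (0, 0)) - taylorCoeff θ 0 • monomial (0, 0) :=
  Mw_adjoint_Mw fun i => inner_monomial_innerSndOp h i 0 0

theorem Mw_adjoint_Mw_adjoint_Mw_innerSndOp :
    Mw (adjoint Mw (adjoint Mw (innerSndOp h (monomial (0, 0))))) =
      adjoint Mw (innerSndOp h (monomial (0, 0))) - taylorCoeff θ 1 • monomial (0, 0) :=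
  Mw_adjoint_Mw fun i => by rw [inner_monomial_adjoint_Mw, inner_monomial_innerSndOp]

end SecondVariable

/-- The identity that double commutativity imposes on the second inner function: `y'` is the
projection to the quotient module of `M_w M_z* f` for `f = (z / w) M_w* θ₂`. -/
theorem IsDoublyCommuting.adjoint_Mw_eq {θ₁ θ₂ : ℂ → ℂ} (h₁ : IsInner θ₁) (h₂ : IsInner θ₂)
    (hQ : (quotientModule fun p => θ₁ (p.1 / p.2) * θ₂ p.2).IsDoublyCommuting)
    {g : HardySpace} (hg : innerDivOp h₁ g = monomial (1, 0)) {y' : HardySpace}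
    (hy' : y' ∈ (quotientModule fun p => θ₁ (p.1 / p.2) * θ₂ p.2).toSubmodule)
    (h : adjoint Mw (innerSndOp h₂ (monomial (0, 0))) - taylorCoeff θ₂ 1 • monomial (0, 0) - y' ∈
      (quotientModule fun p => θ₁ (p.1 / p.2) * θ₂ p.2).toSubmoduleᗮ) :
    (taylorCoeff θ₂ 0 * conj (taylorCoeff θ₂ 0)) •
      adjoint Mw (innerSndOp h₂ (monomial (0, 0))) = y' := by
  set a := taylorCoeff θ₂ 0 with ha
  have hUV : ∀ f, divOp (Mw f) = Mw (divOp f) := mulOp_comm _ _ _ _ _ _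
  have hf : divOp (adjoint Mw (innerSndOp h₂ (monomial (0, 0)))) =
      adjoint Mw (innerSndOp h₂ (monomial (1, 0))) := by
    rw [← adjoint_Mw_divOp, divOp_innerSndOp]
  -- Multiplying this vector by w gives B e_{10} - a e_{10}. The choice of `y` replaces e_{10} by
  -- its kernel part, leaving the remainder (1 - |a|²) B e_{10}, a multiple of θ₁θ₂ because e_{10}
  -- is in the range of A.
  have key := hQ.adjoint_Mz_eq (f := divOp (adjoint Mw (innerSndOp h₂ (monomial (0, 0)))))
    (y := -a • (monomial (1, 0) - conj a • innerSndOp h₂ (monomial (1, 0)))) (y' := y')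
    (mem_quotientModule_of_snd h₁ h₂ (by rw [hf, adjoint_innerSndOp_adjoint_Mw]))
    (mem_quotientModule_of_snd h₁ h₂ (by rw [map_smul, adjoint_innerSndOp_sub, smul_zero]))
    hy'
    (mem_orthogonal_of_multiples ((1 - a * conj a) • g) fun p hp => by
      have e : Mw (divOp (adjoint Mw (innerSndOp h₂ (monomial (0, 0))))) -
          -a • (monomial (1, 0) - conj a • innerSndOp h₂ (monomial (1, 0))) =
          (1 - a * conj a) • innerSndOp h₂ (innerDivOp h₁ g) := by
        rw [← hUV, Mw_adjoint_Mw_innerSndOp, map_sub, map_smul, divOp_innerSndOp,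
          divOp_monomial, hg]
        module
      rw [e, smul_apply, smul_apply, innerSndOp, innerDivOp, mulOp_apply, mulOp_apply]
      ring)
    (by
      rw [adjoint_Mz_apply, adjoint_divOp_divOp, Mw_adjoint_Mw_adjoint_Mw_innerSndOp]
      exact h)
  rw [← key, adjoint_Mz_apply, ← divOp_innerSndOp, ← divOp_monomial]
  simp only [map_smul, map_sub, adjoint_divOp_divOp, adjoint_Mw_monomial_zero]
  module

/-! ### Inner functions determined by their coefficients -/

theorem one_sub_conj_mul_ne_zero {b w : ℂ} (hb : ‖b‖ < 1) (hw : ‖w‖ < 1) : 1 - conj b * w ≠ 0 := by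
  intro h
  have : ‖conj b * w‖ < 1 := by
    rw [norm_mul, RCLike.norm_conj]
    exact mul_lt_one_of_nonneg_of_lt_one_left (norm_nonneg _) hb hw.le
  rw [← sub_eq_zero.1 h, norm_one] at this
  exact lt_irrefl _ this

namespace IsInner

theorem norm_eq_one_of_const {θ : ℂ → ℂ} (h : IsInner θ) {c : ℂ}
    (hc : ∀ z ∈ Metric.ball (0 : ℂ) 1, θ z = c) : ‖c‖ = 1 := by
  obtain ⟨t, ζ, hζ, hlim⟩ := h.radial_limit.exists
  have h1 : Tendsto (fun _ : ℝ => c) (𝓝[<] 1) (𝓝 ζ) := hlim.congr' (by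
    filter_upwards [Ioo_mem_nhdsLT (zero_lt_one' ℝ)] with r hr
    exact hc _ (mem_ball_zero_iff.2 (norm_mul_exp_lt hr.1.le hr.2 t)))
  rw [tendsto_nhds_unique tendsto_const_nhds h1, hζ]

theorem hasSum_sq_taylorCoeff {θ : ℂ → ℂ} (h : IsInner θ) :
    HasSum (fun n => ‖taylorCoeff θ n‖ ^ 2) 1 := by
  have h1 := h.hasSum_conj_taylorCoeff 0
  simp only [add_zero, conj_mul', if_true] at h1
  exact Complex.hasSum_ofReal.1 (by push_cast; exact h1)

theorem hasSum_sq_taylorCoeff_succ {θ : ℂ → ℂ} (h : IsInner θ) :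
    HasSum (fun n => ‖taylorCoeff θ (n + 1)‖ ^ 2) (1 - ‖taylorCoeff θ 0‖ ^ 2) := by
  simpa using (hasSum_nat_add_iff' 1).2 h.hasSum_sq_taylorCoeff

theorem const_of_taylorCoeff {θ : ℂ → ℂ} (h : IsInner θ) (h0 : ∀ n, taylorCoeff θ (n + 1) = 0) :
    ∃ c : ℂ, ∀ z ∈ Metric.ball (0 : ℂ) 1, θ z = c := by
  refine ⟨taylorCoeff θ 0, fun z hz => ?_⟩
  refine (h.hasSum_taylorCoeff (mem_ball_zero_iff.1 hz)).unique ?_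
  have := hasSum_single (f := fun n => taylorCoeff θ n * z ^ n) 0 fun n hn => by
    obtain ⟨m, rfl⟩ := Nat.exists_eq_succ_of_ne_zero hn
    simp [h0]
  simpa using this

/-- The squared coefficients sum to one, so |θ(0)| = 1 leaves nothing for the others. -/
theorem const_of_norm_taylorCoeff_zero {θ : ℂ → ℂ} (h : IsInner θ)
    (h0 : 1 - ‖taylorCoeff θ 0‖ ^ 2 = 0) : ∃ c : ℂ, ∀ z ∈ Metric.ball (0 : ℂ) 1, θ z = c := by
  have h1 := h.hasSum_sq_taylorCoeff_succ
  rw [h0, hasSum_zero_iff_of_nonneg fun n => by positivity] at h1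
  exact h.const_of_taylorCoeff fun n => by simpa using congrFun h1 n

/-- An affine inner function is constant or a rotation. -/
theorem const_or_rotation {θ : ℂ → ℂ} (h : IsInner θ) (h0 : ∀ n, taylorCoeff θ (n + 2) = 0) :
    (∃ c : ℂ, ∀ z ∈ Metric.ball (0 : ℂ) 1, θ z = c) ∨
      ∃ c : ℂ, ‖c‖ = 1 ∧ ∀ z ∈ Metric.ball (0 : ℂ) 1, θ z = c * z := by
  -- Orthogonality of θ and zθ reduces to one term, conj(a_0) a_1 = 0, when θ is affine.
  have h1 := hasSum_single (f := fun n => conj (taylorCoeff θ n) * taylorCoeff θ (n + 1)) 0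
    fun n hn => by
      obtain ⟨m, rfl⟩ := Nat.exists_eq_succ_of_ne_zero hn
      simp [h0]
  have h2 := (h.hasSum_conj_taylorCoeff 1).unique h1
  simp only [one_ne_zero, if_false, zero_add, zero_eq_mul, map_eq_zero] at h2
  rcases h2 with h2 | h2
  · refine Or.inr ⟨taylorCoeff θ 1, ?_, fun z hz => ?_⟩
    · have h3 := h.hasSum_sq_taylorCoeff_succ
      have h4 := hasSum_single (f := fun n => ‖taylorCoeff θ (n + 1)‖ ^ 2) 0 fun n hn => by
        obtain ⟨m, rfl⟩ := Nat.exists_eq_succ_of_ne_zero hn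
        simp [h0]
      have h5 := h4.unique h3
      rw [h2, norm_zero] at h5
      exact (pow_eq_one_iff_of_nonneg (norm_nonneg _) two_ne_zero).1 (by simpa using h5)
    · refine (h.hasSum_taylorCoeff (mem_ball_zero_iff.1 hz)).unique ?_
      have := hasSum_single (f := fun n => taylorCoeff θ n * z ^ n) 1 fun n hn => by
        match n, hn with
        | 0, _ => simp [h2]
        | n + 2, _ => simp [h0]
      simpa using this
  · refine Or.inl (h.const_of_taylorCoeff fun n => ?_)
    cases n with
    | zero => exact h2
    | succ n => exact h0 n

/-- Summed against powers of w, the recurrence is a linear equation for θ(w) whose solution is a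
Möbius map; summed against conjugate coefficients, it shows that the leading factor is unimodular.
-/
theorem blaschke_of_taylorCoeff {θ : ℂ → ℂ} (h : IsInner θ) (hN : 1 - ‖taylorCoeff θ 0‖ ^ 2 ≠ 0)
    (hrec : ∀ j, (1 - taylorCoeff θ 0 * conj (taylorCoeff θ 0)) * taylorCoeff θ (j + 1) =
      taylorCoeff θ 1 * ((if j = 0 then 1 else 0) - conj (taylorCoeff θ 0) * taylorCoeff θ j)) :
    ∃ b ∈ Metric.ball (0 : ℂ) 1, ∃ c : ℂ, ‖c‖ = 1 ∧
      ∀ w ∈ Metric.ball (0 : ℂ) 1, θ w = c * ((w - b) / (1 - conj b * w)) := by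
  set a := taylorCoeff θ with ha
  set N : ℝ := 1 - ‖a 0‖ ^ 2 with hNdef
  have hNc : (1 - a 0 * conj (a 0) : ℂ) = N := by
    rw [mul_conj', hNdef]
    push_cast
    rfl
  have hN0 : (N : ℂ) ≠ 0 := by exact_mod_cast hN
  have hNpos : 0 < N := lt_of_le_of_ne
    (h.hasSum_sq_taylorCoeff_succ.nonneg fun n => by positivity) (Ne.symm hN)
  simp only [hNc] at hrec
  have hdelta : ∀ x : ℕ → ℂ, HasSum (fun j => (if j = 0 then 1 else 0) * x j) (x 0) := fun x => by
    have := hasSum_single (f := fun j => (if j = 0 then (1 : ℂ) else 0) * x j) 0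
      fun n hn => by simp [hn]
    simpa using this
  -- Multiply the recurrence by conj(a_{j+1}) and sum over j. The left side gives N·N, and the term
  -- with conj(a_0) drops out by orthogonality of θ and zθ.
  have hnorm : a 1 * conj (a 1) = N * N := by
    have h1 : HasSum (fun j => (‖a (j + 1)‖ ^ 2 : ℂ)) N := by
      exact_mod_cast h.hasSum_sq_taylorCoeff_succ
    have h2 := h1.mul_left (N : ℂ)
    have h3 := (h.hasSum_conj_taylorCoeff 1)
    rw [if_neg one_ne_zero] at h3
    have h4 := hasSum_conj'.2 h3
    have h5 := ((hdelta fun j => conj (a (j + 1))).sub (h4.mul_left (conj (a 0)))).mul_left (a 1)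
    rw [map_zero, mul_zero, sub_zero] at h5
    refine h5.unique (h2.congr_fun fun j => ?_)
    rw [← mul_conj', ← mul_assoc, hrec, map_mul, conj_conj]
    ring
  set l : ℂ := a 1 / N with hl
  have ha1 : a 1 = N * l := by rw [hl]; field_simp
  have hll : l * conj l = 1 := by
    rw [hl, map_div₀, conj_ofReal, div_mul_div_comm, hnorm, div_self (mul_ne_zero hN0 hN0)]
  have hl1 : ‖l‖ = 1 := by
    rw [mul_conj'] at hll
    exact (pow_eq_one_iff_of_nonneg (norm_nonneg _) two_ne_zero).1 (by exact_mod_cast hll)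
  have hb : ‖-a 0 * conj l‖ < 1 := by
    rw [norm_mul, norm_neg, RCLike.norm_conj, hl1, mul_one]
    exact (sq_lt_one_iff₀ (norm_nonneg _)).1 (by linarith)
  -- With c = l, the value θ(0) = -c b = a_0 dictates b.
  refine ⟨-a 0 * conj l, mem_ball_zero_iff.2 hb, l, hl1, fun w hw => ?_⟩
  have hw1 := mem_ball_zero_iff.1 hw
  have hden := one_sub_conj_mul_ne_zero hb hw1
  have hs := h.hasSum_taylorCoeff hw1
  have hs1 : HasSum (fun j => a (j + 1) * w ^ (j + 1)) (θ w - a 0) := by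
    simpa using (hasSum_nat_add_iff' 1).2 hs
  -- The recurrence times w^{j+1}, summed: N (θ - a_0) = a_1 (w - conj(a_0) w θ).
  have h6 := ((hdelta fun j => w ^ (j + 1)).sub (hs.mul_left (conj (a 0) * w))).mul_left (a 1)
  have h7 := h6.unique ((hs1.mul_left (N : ℂ)).congr_fun fun j => by
    rw [← mul_assoc (N : ℂ), hrec]
    ring)
  rw [mul_div_assoc', eq_div_iff hden, map_mul, map_neg, conj_conj]
  rw [ha1, zero_add, pow_one] at h7
  have h8 : l * (w - conj (a 0) * w * θ w) = θ w - a 0 :=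
    mul_left_cancel₀ hN0 (by rw [← h7]; ring)
  linear_combination -h8 - a 0 * hll

end IsInner

/-! ### Necessity: the two cases for the first inner function -/

theorem rotation_or_const_of_fst_rotation {θ₁ θ₂ : ℂ → ℂ} (h₁ : IsInner θ₁) (h₂ : IsInner θ₂)
    (hQ : (quotientModule fun p => θ₁ (p.1 / p.2) * θ₂ p.2).IsDoublyCommuting)
    {c : ℂ} (hc1 : ‖c‖ = 1) (hc : ∀ z ∈ Metric.ball (0 : ℂ) 1, θ₁ z = c * z) :
    (∃ c₂ : ℂ, ∀ w ∈ Metric.ball (0 : ℂ) 1, θ₂ w = c₂) ∨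
      ∃ c₂ : ℂ, ‖c₂‖ = 1 ∧ ∀ w ∈ Metric.ball (0 : ℂ) 1, θ₂ w = c₂ * w := by
  have hc0 : c ≠ 0 := norm_pos_iff.1 (by rw [hc1]; exact one_pos)
  have hA : ∀ f, innerDivOp h₁ f = c • divOp f := fun f => HardySpace.ext fun p hp => by
    rw [smul_apply, innerDivOp, divOp, mulOp_apply, mulOp_apply,
      hc _ (mem_ball_zero_iff.2 (norm_div_lt_one hp)), mul_assoc]
  -- The adjoint of A is a multiple of the backward shift in the first index, and this vector has
  -- only components with first index 0. Hence it lies in Q and serves as its own projection.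
  have hy : adjoint (innerDivOp h₁) (adjoint Mw (innerSndOp h₂ (monomial (0, 0))) -
      taylorCoeff θ₂ 1 • monomial (0, 0)) = 0 := ext_inner_monomial fun ⟨i, j⟩ => by
    rw [adjoint_inner_right, hA, divOp_monomial, inner_smul_left, inner_sub_right,
      inner_smul_right, inner_monomial_adjoint_Mw, inner_monomial_innerSndOp,
      inner_monomial_monomial]
    simp
  have key := IsDoublyCommuting.adjoint_Mw_eq h₁ h₂ hQ (g := c⁻¹ • monomial (0, 0))
    (by rw [hA, map_smul, smul_inv_smul₀ hc0, divOp_monomial])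
    (mem_quotientModule h₁ h₂ (by rw [hy, map_zero]))
    (by rw [sub_self]; exact Submodule.zero_mem _)
  by_cases hN : 1 - ‖taylorCoeff θ₂ 0‖ ^ 2 = 0
  · exact Or.inl (h₂.const_of_norm_taylorCoeff_zero hN)
  · refine h₂.const_or_rotation fun n => ?_
    -- Index n + 1 avoids the correction at (0, 0); the identity then reads (1 - |b_0|²) b_{n+2} =
    -- 0.
    have h3 := congrArg (inner ℂ (monomial (0, n + 1))) key
    rw [inner_smul_right, inner_sub_right, inner_smul_right, inner_monomial_adjoint_Mw,
      inner_monomial_innerSndOp, inner_monomial_monomial, mul_conj'] at h3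
    simp only [if_true, Prod.mk.injEq, Nat.succ_ne_zero, and_false, if_false, mul_zero,
      sub_zero] at h3
    have hNc : (1 - (‖taylorCoeff θ₂ 0‖ : ℂ) ^ 2) ≠ 0 := by exact_mod_cast hN
    exact (mul_eq_zero.1 (show (1 - (‖taylorCoeff θ₂ 0‖ : ℂ) ^ 2) * taylorCoeff θ₂ (n + 2) = 0 by
      linear_combination -h3)).resolve_left hNc

theorem const_or_blaschke_of_fst_const {θ₁ θ₂ : ℂ → ℂ} (h₁ : IsInner θ₁) (h₂ : IsInner θ₂)
    (hQ : (quotientModule fun p => θ₁ (p.1 / p.2) * θ₂ p.2).IsDoublyCommuting)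
    {c : ℂ} (hc : ∀ z ∈ Metric.ball (0 : ℂ) 1, θ₁ z = c) :
    (∃ c₂ : ℂ, ∀ w ∈ Metric.ball (0 : ℂ) 1, θ₂ w = c₂) ∨
      ∃ b ∈ Metric.ball (0 : ℂ) 1, ∃ c : ℂ, ‖c‖ = 1 ∧
        ∀ w ∈ Metric.ball (0 : ℂ) 1, θ₂ w = c * ((w - b) / (1 - conj b * w)) := by
  have hc0 : c ≠ 0 := norm_pos_iff.1 (by rw [h₁.norm_eq_one_of_const hc]; exact one_pos)
  have hA : ∀ f, innerDivOp h₁ f = c • f := fun f => HardySpace.ext fun p hp => by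
    rw [smul_apply, innerDivOp, mulOp_apply, hc _ (mem_ball_zero_iff.2 (norm_div_lt_one hp))]
  -- Here `y'` replaces e_{00} by its projection e_{00} - conj(b_0) B e_{00}. The discarded multiple
  -- of B e_{00} lies in θ₁θ₂ H² because θ₁ is a nonzero constant.
  have key := IsDoublyCommuting.adjoint_Mw_eq h₁ h₂ hQ (g := c⁻¹ • monomial (1, 0))
    (y' := adjoint Mw (innerSndOp h₂ (monomial (0, 0))) - taylorCoeff θ₂ 1 • (monomial (0, 0) -
      conj (taylorCoeff θ₂ 0) • innerSndOp h₂ (monomial (0, 0))))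
    (by rw [hA, smul_inv_smul₀ hc0])
    (mem_quotientModule_of_snd h₁ h₂ (by
      rw [map_sub, map_smul, adjoint_innerSndOp_adjoint_Mw, adjoint_innerSndOp_sub, smul_zero,
        sub_zero]))
    (mem_orthogonal_of_multiples
      ((-(taylorCoeff θ₂ 1 * conj (taylorCoeff θ₂ 0)) * c⁻¹) • monomial (0, 0)) fun p hp => by
      have e : ∀ x y : HardySpace, x - taylorCoeff θ₂ 1 • monomial (0, 0) -
          (x - taylorCoeff θ₂ 1 • (monomial (0, 0) - conj (taylorCoeff θ₂ 0) • y)) =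
          -(taylorCoeff θ₂ 1 * conj (taylorCoeff θ₂ 0)) • y := fun x y => by module
      rw [e, smul_apply, smul_apply, innerSndOp, mulOp_apply,
        hc _ (mem_ball_zero_iff.2 (norm_div_lt_one hp))]
      field_simp)
  by_cases hN : 1 - ‖taylorCoeff θ₂ 0‖ ^ 2 = 0
  · exact Or.inl (h₂.const_of_norm_taylorCoeff_zero hN)
  · refine Or.inr (h₂.blaschke_of_taylorCoeff hN fun j => ?_)
    -- The coefficient at (0, j) is exactly the recurrence required for a Blaschke factor.
    have h3 := congrArg (inner ℂ (monomial (0, j))) key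
    rw [inner_smul_right, inner_sub_right, inner_smul_right, inner_sub_right, inner_smul_right,
      inner_monomial_adjoint_Mw, inner_monomial_innerSndOp, inner_monomial_innerSndOp,
      inner_monomial_monomial] at h3
    simp only [if_true, Prod.mk.injEq, true_and] at h3
    linear_combination -h3

/-! ### Sufficiency and the theorem -/

/-- If z H² ⊆ θ H², then `Mz` compresses to zero on the quotient. -/
theorem isDoublyCommuting_of_Mz_mem_multiples {θ : ℂ × ℂ → ℂ}
    (h : ∀ f : HardySpace, ∃ k : HardySpace, ∀ p ∈ hartogsTriangle, p.1 * f p = θ p * k p) :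
    (quotientModule θ).IsDoublyCommuting := by
  refine QuotientModule.isDoublyCommuting_of_compression_Mz _ (ContinuousLinearMap.ext fun f => ?_)
  obtain ⟨k, hk⟩ := h f
  refine QuotientModule.compression_eq _ _ f 0 ?_
  rw [Submodule.coe_zero, sub_zero]
  exact mem_orthogonal_of_multiples k hk

/-- If (w - b) H² ⊆ θ H², then `Mw` compresses to the scalar b, which commutes with everything. -/
theorem isDoublyCommuting_of_Mw_sub_mem_multiples {θ : ℂ × ℂ → ℂ} (b : ℂ)
    (h : ∀ f : HardySpace, ∃ k : HardySpace, ∀ p ∈ hartogsTriangle,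
      (p.2 - b) * f p = θ p * k p) :
    (quotientModule θ).IsDoublyCommuting := by
  refine QuotientModule.isDoublyCommuting_of_compression_Mw _ (b := b)
    (ContinuousLinearMap.ext fun f => ?_)
  obtain ⟨k, hk⟩ := h f
  refine QuotientModule.compression_eq _ _ f (b • f) ?_
  refine mem_orthogonal_of_multiples k fun p hp => ?_
  rw [← hk p hp, sub_mul]
  rfl

end Hartogs

open Hartogs

theorem theorem1p2 (θ₁ θ₂ : ℂ → ℂ) (h₁ : Hartogs.IsInner θ₁) (h₂ : Hartogs.IsInner θ₂) :
    (Hartogs.quotientModule fun p => θ₁ (p.1 / p.2) * θ₂ p.2).IsDoublyCommuting ↔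
      ((∃ c₁ : ℂ, ∀ z ∈ Metric.ball (0 : ℂ) 1, θ₁ z = c₁) ∧
        (∃ c₂ : ℂ, ∀ w ∈ Metric.ball (0 : ℂ) 1, θ₂ w = c₂)) ∨
      ((∃ c₁ : ℂ, ∀ z ∈ Metric.ball (0 : ℂ) 1, θ₁ z = c₁) ∧
        (∃ b ∈ Metric.ball (0 : ℂ) 1, ∃ c : ℂ, ‖c‖ = 1 ∧
          ∀ w ∈ Metric.ball (0 : ℂ) 1, θ₂ w = c * ((w - b) / (1 - starRingEnd ℂ b * w)))) ∨
      ((∃ c₂ : ℂ, ∀ w ∈ Metric.ball (0 : ℂ) 1, θ₂ w = c₂) ∧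
        (∃ c₁ : ℂ, ‖c₁‖ = 1 ∧ ∀ z ∈ Metric.ball (0 : ℂ) 1, θ₁ z = c₁ * z)) ∨
      ((∃ c₁ : ℂ, ‖c₁‖ = 1 ∧ ∀ z ∈ Metric.ball (0 : ℂ) 1, θ₁ z = c₁ * z) ∧
        (∃ c₂ : ℂ, ‖c₂‖ = 1 ∧ ∀ w ∈ Metric.ball (0 : ℂ) 1, θ₂ w = c₂ * w)) := by
  have hne : ∀ {c : ℂ}, ‖c‖ = 1 → c ≠ 0 := fun hc => norm_pos_iff.1 (by rw [hc]; exact one_pos)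
  have hdiv : ∀ {p : ℂ × ℂ}, p ∈ hartogsTriangle → p.1 / p.2 ∈ Metric.ball (0 : ℂ) 1 :=
    fun hp => mem_ball_zero_iff.2 (norm_div_lt_one hp)
  have hsnd : ∀ {p : ℂ × ℂ}, p ∈ hartogsTriangle → p.2 ∈ Metric.ball (0 : ℂ) 1 :=
    fun hp => mem_ball_zero_iff.2 hp.2
  constructor
  · intro hQ
    rcases h₁.const_or_rotation (taylorCoeff_fst_eq_zero h₁ h₂ hQ) with ⟨c, hc⟩ | ⟨c, hc1, hc⟩
    · rcases const_or_blaschke_of_fst_const h₁ h₂ hQ hc with h | h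
      · exact Or.inl ⟨⟨c, hc⟩, h⟩
      · exact Or.inr (Or.inl ⟨⟨c, hc⟩, h⟩)
    · rcases rotation_or_const_of_fst_rotation h₁ h₂ hQ hc1 hc with h | h
      · exact Or.inr (Or.inr (Or.inl ⟨h, c, hc1, hc⟩))
      · exact Or.inr (Or.inr (Or.inr ⟨⟨c, hc1, hc⟩, h⟩))
  · rintro (⟨⟨c₁, hc₁⟩, c₂, hc₂⟩ | ⟨⟨c₁, hc₁⟩, b, hb, c, hc1, hc⟩ | ⟨⟨c₂, hc₂⟩, c₁, hn₁, hc₁⟩ |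
      ⟨⟨c₁, hn₁, hc₁⟩, c₂, hn₂, hc₂⟩)
    · have e₁ := hne (h₁.norm_eq_one_of_const hc₁)
      have e₂ := hne (h₂.norm_eq_one_of_const hc₂)
      refine isDoublyCommuting_of_Mz_mem_multiples fun f => ⟨(c₁ * c₂)⁻¹ • Mz f, fun p hp => ?_⟩
      rw [hc₁ _ (hdiv hp), hc₂ _ (hsnd hp), HardySpace.smul_apply, Mz, mulOp_apply]
      field_simp
    · have e₁ := hne (h₁.norm_eq_one_of_const hc₁)
      have e := hne hc1
      -- The witness is (1 - conj(b) w) f up to a constant: this factor cancels the denominator of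
      -- the Blaschke factor.
      refine isDoublyCommuting_of_Mw_sub_mem_multiples b fun f =>
        ⟨(c₁ * c)⁻¹ • (f + (-starRingEnd ℂ b) • Mw f), fun p hp => ?_⟩
      have hden : 1 - p.2 * starRingEnd ℂ b ≠ 0 := by
        rw [mul_comm]
        exact one_sub_conj_mul_ne_zero (mem_ball_zero_iff.1 hb) hp.2
      have hf : f p + -starRingEnd ℂ b * (p.2 * f p) = (1 - starRingEnd ℂ b * p.2) * f p := by
        ring
      rw [hc₁ _ (hdiv hp), hc _ (hsnd hp), HardySpace.smul_apply, HardySpace.add_apply,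
        HardySpace.smul_apply, Mw, mulOp_apply, hf]
      field_simp
    · have e₂ := hne (h₂.norm_eq_one_of_const hc₂)
      have e₁ := hne hn₁
      -- Here θ₁θ₂ is a constant times z/w, and z = (z/w) w.
      refine isDoublyCommuting_of_Mz_mem_multiples fun f => ⟨(c₁ * c₂)⁻¹ • Mw f, fun p hp => ?_⟩
      have := snd_ne_zero hp
      rw [hc₁ _ (hdiv hp), hc₂ _ (hsnd hp), HardySpace.smul_apply, Mw, mulOp_apply]
      field_simp
    · have e₁ := hne hn₁
      have e₂ := hne hn₂
      -- Here θ₁(z/w) θ₂(w) is itself a constant times z.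
      refine isDoublyCommuting_of_Mz_mem_multiples fun f => ⟨(c₁ * c₂)⁻¹ • f, fun p hp => ?_⟩
      have := snd_ne_zero hp
      rw [hc₁ _ (hdiv hp), hc₂ _ (hsnd hp), HardySpace.smul_apply]
      field_simp
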